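/- For positive integers $p,q$ let $\mathcal{Z}_{p,q}$ be the dimension drop algebra of all continuous functions $f\colon[0,1]\to \mathbb{M}_p\otimes\mathbb{M}_q$ with $f(0)\in\mathbb{M}_p\otimes 1$ and $f(1)\in 1\otimes\mathbb{M}_q$; it is called prime if $p$ and $q$ are coprime. Write $c(f(0))=a$ if $f(0)=a\otimes 1$, and $c(f(1))=b$ if $f(1)=1\otimes b$. Every unital $*$-homomorphism $\varphi\colon\mathcal{Z}_{p,q}\to\mathcal{Z}_{p',q'}$ has a unique normalized eigenvalue pattern, that is, there are unique continuous functions $t_1\le\dots\le t_k$ from $[0,1]$ to $[0,1]$ such that, for some integers $0\le a<q$ and $0\le b<p$ and some unitary matrices $v_s$ $(s\in[0,1])$ of size $p'q'$, \[ \varphi(f)(s)=v_s\,\operatorname{diag}\bigl[\underbrace{c(f(0)),\dots,c(f(0))}_{a},\,f(t_1(s)),\dots,f(t_k(s)),\,\underbrace{c(f(1)),\dots,c(f(1))}_{b}\bigr]\,v_s^* \] for all $f\in\mathcal{Z}_{p,q}$ and $s\in[0,1]$. **Lemma.** Let $(\mathcal{Z}_n)_n$, $\mathcal{Z}_n=\mathcal{Z}_{p_n,q_n}$,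 be prime dimension drop algebras, let $\iota_{n,m}\colon\mathcal{Z}_m\to\mathcal{Z}_n$ $(m\le n)$ be unital $*$-homomorphisms forming an inductive system, and let $\mathcal{Z}_0$ be its C*-algebraic inductive limit. Let $t^{m,n}_1\le\dots\le t^{m,n}_{k(m,n)}$ be the normalized eigenvalue pattern of $\iota_{n,m}$, and for $y\in[0,1]$ and $\varepsilon>0$ put \[ c_{m,n}(y,\varepsilon)=\#\bigl\{\,i \;\bigm|\; \min t^{m,n}_i<y-\varepsilon \text{ and } \max t^{m,n}_i>y+\varepsilon\,\bigr\}. \] Then the following are equivalent. 1. $\mathcal{Z}_0$ has exactly one tracial state. 2. For all $y\in[0,1]$, all $\varepsilon>0$ and all $m$, \[ \lim_{n\to\infty}\frac{c_{m,n}(y,\varepsilon)}{k(m,n)}=0 . \] (If $k(m,n)=0$, which can happen only when $p_m=1$ or $q_m=1$, the quotient is read as $0$.) -/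

import Mathlib

open Filter Topology
open scoped Matrix.Norms.L2Operator

noncomputable section

/-! ### Inductive limits of sequences of unital C*-algebras -/

/-- An inductive sequence of unital C*-algebras with unital `*`-homomorphisms as
connecting maps. -/
structure CStarSequence (A : ℕ → Type) [∀ n, CStarAlgebra (A n)] where
  map : ∀ {m n : ℕ}, m ≤ n → (A m →⋆ₐ[ℂ] A n)
  map_refl : ∀ (m : ℕ) (x : A m), map (le_refl m) x = x
  map_trans : ∀ {l m n : ℕ} (h₁ : l ≤ m) (h₂ : m ≤ n) (x : A l),
    map (h₁.trans h₂) x = map h₂ (map h₁ x)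

namespace CStarSequence

variable {A : ℕ → Type} [∀ n, CStarAlgebra (A n)] (S : CStarSequence A)

/-- The `*`-algebra of all sequences `(xₙ)` in `∏ₙ Aₙ` that are eventually coherent, that is,
for which the connecting maps send `xₘ` to `xₙ` whenever `n ≥ m` and `m` is large. Up to
sequences of seminorm zero (for the seminorm below) it is the algebraic inductive limit. -/
def coherent : StarSubalgebra ℂ (∀ n, A n) where
  carrier := {x | ∃ N, ∀ m n (h : m ≤ n), N ≤ m → S.map h (x m) = x n}
  mul_mem' := by
    rintro x y ⟨N, hx⟩ ⟨M, hy⟩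
    refine ⟨max N M, fun m n h hm => ?_⟩
    rw [Pi.mul_apply, Pi.mul_apply, map_mul, hx m n h (le_trans (le_max_left _ _) hm),
      hy m n h (le_trans (le_max_right _ _) hm)]
  add_mem' := by
    rintro x y ⟨N, hx⟩ ⟨M, hy⟩
    refine ⟨max N M, fun m n h hm => ?_⟩
    rw [Pi.add_apply, Pi.add_apply, map_add, hx m n h (le_trans (le_max_left _ _) hm),
      hy m n h (le_trans (le_max_right _ _) hm)]
  algebraMap_mem' := fun c => ⟨0, fun m n h _ => by
    simp only [Pi.algebraMap_apply]
    exact AlgHomClass.commutes (S.map h) c⟩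
  star_mem' := by
    rintro x ⟨N, hx⟩
    refine ⟨N, fun m n h hm => ?_⟩
    rw [Pi.star_apply, Pi.star_apply, map_star, hx m n h hm]

/-- The eventually coherent sequences, as a type that carries the seminorm
`‖(xₙ)‖ = limₙ ‖xₙ‖` (and not the product topology). -/
def PreLimit : Type := S.coherent

instance : Ring S.PreLimit := inferInstanceAs (Ring S.coherent)
instance : StarRing S.PreLimit := inferInstanceAs (StarRing S.coherent)
instance : Algebra ℂ S.PreLimit := inferInstanceAs (Algebra ℂ S.coherent)
instance : StarModule ℂ S.PreLimit := inferInstanceAs (StarModule ℂ S.coherent)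

/-- The `n`-th entry of an eventually coherent sequence. -/
def PreLimit.entry {S : CStarSequence A} (x : S.PreLimit) (n : ℕ) : A n := x.1 n

instance : Norm S.PreLimit := ⟨fun x => limUnder atTop fun n => ‖x.entry n‖⟩

theorem PreLimit.norm_def {S : CStarSequence A} (x : S.PreLimit) :
    ‖x‖ = limUnder atTop fun n => ‖x.entry n‖ := rfl

theorem PreLimit.tendsto_norm {S : CStarSequence A} (x : S.PreLimit) :
    Tendsto (fun n => ‖x.entry n‖) atTop (𝓝 ‖x‖) := by
  obtain ⟨N, hN⟩ := x.2
  have hanti : Antitone fun n => ‖x.entry (n + N)‖ := by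
    intro m n h
    have h' : m + N ≤ n + N := by omega
    have e : S.map h' (x.entry (m + N)) = x.entry (n + N) := hN _ _ h' (by omega)
    simp only
    rw [← e]
    exact NonUnitalStarAlgHom.norm_apply_le (S.map h') _
  have hb : BddBelow (Set.range fun n => ‖x.entry (n + N)‖) :=
    ⟨0, by rintro _ ⟨n, rfl⟩; exact norm_nonneg _⟩
  have h1 := tendsto_atTop_ciInf hanti hb
  have h2 := (tendsto_add_atTop_iff_nat (f := fun n => ‖x.entry n‖) N).1 h1
  rw [PreLimit.norm_def, h2.limUnder_eq]
  exact h2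

/-- The seminorm `limₙ ‖xₙ‖`. -/
def preLimitSeminorm : AddGroupSeminorm S.PreLimit where
  toFun x := ‖x‖
  map_zero' := tendsto_nhds_unique (PreLimit.tendsto_norm 0)
    (tendsto_const_nhds.congr fun n => (norm_zero (E := A n)).symm)
  add_le' x y := le_of_tendsto_of_tendsto' (x + y).tendsto_norm
    (x.tendsto_norm.add y.tendsto_norm) fun n => norm_add_le (x.entry n) (y.entry n)
  neg' x := tendsto_nhds_unique (-x).tendsto_norm
    (x.tendsto_norm.congr fun n => (norm_neg (x.entry n)).symm)

instance : SeminormedAddCommGroup S.PreLimit :=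
  S.preLimitSeminorm.toSeminormedAddCommGroup

instance : SeminormedRing S.PreLimit where
  __ := (inferInstance : Ring S.PreLimit)
  __ := (inferInstance : SeminormedAddCommGroup S.PreLimit)
  norm_mul_le x y := le_of_tendsto_of_tendsto' (x * y).tendsto_norm
    (x.tendsto_norm.mul y.tendsto_norm) fun n => norm_mul_le (x.entry n) (y.entry n)

instance : NormedSpace ℂ S.PreLimit where
  norm_smul_le c x := le_of_tendsto_of_tendsto' (c • x).tendsto_norm
    (x.tendsto_norm.const_mul ‖c‖) fun n => norm_smul_le c (x.entry n)

theorem PreLimit.norm_star {S : CStarSequence A} (x : S.PreLimit) : ‖star x‖ = ‖x‖ :=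
  tendsto_nhds_unique (star x).tendsto_norm
    (x.tendsto_norm.congr fun n => (_root_.norm_star (x.entry n)).symm)

theorem PreLimit.norm_star_mul_self {S : CStarSequence A} (x : S.PreLimit) :
    ‖star x * x‖ = ‖x‖ * ‖x‖ :=
  tendsto_nhds_unique (star x * x).tendsto_norm
    ((x.tendsto_norm.mul x.tendsto_norm).congr fun n =>
      (CStarRing.norm_star_mul_self (x := x.entry n)).symm)

/-- The C*-algebraic inductive limit: the Hausdorff completion of the eventually coherent
sequences with respect to the C*-seminorm `limₙ ‖xₙ‖`. -/
def Limit : Type := UniformSpace.Completion S.PreLimit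


instance : NormedRing S.Limit :=
  inferInstanceAs (NormedRing (UniformSpace.Completion S.PreLimit))

instance : CompleteSpace S.Limit :=
  inferInstanceAs (CompleteSpace (UniformSpace.Completion S.PreLimit))

/-- The canonical map from eventually coherent sequences to the limit. -/
def toLimit : S.PreLimit → S.Limit := fun x => (x : UniformSpace.Completion S.PreLimit)

theorem denseRange_toLimit : DenseRange S.toLimit :=
  UniformSpace.Completion.denseRange_coe

theorem norm_toLimit (x : S.PreLimit) : ‖S.toLimit x‖ = ‖x‖ :=
  UniformSpace.Completion.norm_coe x

theorem continuous_toLimit : Continuous S.toLimit :=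
  UniformSpace.Completion.continuous_coe _

theorem toLimit_mul (x y : S.PreLimit) : S.toLimit (x * y) = S.toLimit x * S.toLimit y :=
  UniformSpace.Completion.coe_mul x y

theorem toLimit_add (x y : S.PreLimit) : S.toLimit (x + y) = S.toLimit x + S.toLimit y :=
  UniformSpace.Completion.coe_add x y

instance : Algebra ℂ S.Limit :=
  inferInstanceAs (Algebra ℂ (UniformSpace.Completion S.PreLimit))

theorem toLimit_smul (c : ℂ) (x : S.PreLimit) : S.toLimit (c • x) = c • S.toLimit x :=
  UniformSpace.Completion.coe_smul c x

instance : NormedAlgebra ℂ S.Limit where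
  norm_smul_le c x := S.denseRange_toLimit.induction_on x
    (isClosed_le (continuous_norm.comp ((continuous_const.mul continuous_id).congr
      fun y => (Algebra.smul_def c y).symm)) (continuous_const.mul continuous_norm))
    fun a => by
      rw [← toLimit_smul, norm_toLimit, norm_toLimit]
      exact norm_smul_le c a

theorem PreLimit.uniformContinuous_star {S : CStarSequence A} :
    UniformContinuous (star : S.PreLimit → S.PreLimit) :=
  (AddMonoidHomClass.isometry_of_norm (starAddEquiv : S.PreLimit ≃+ S.PreLimit)
    PreLimit.norm_star).uniformContinuous

instance : Star S.Limit :=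
  ⟨UniformSpace.Completion.map (star : S.PreLimit → S.PreLimit)⟩

theorem toLimit_star (x : S.PreLimit) : S.toLimit (star x) = star (S.toLimit x) :=
  (UniformSpace.Completion.map_coe PreLimit.uniformContinuous_star x).symm

theorem continuous_star_limit : Continuous (star : S.Limit → S.Limit) :=
  UniformSpace.Completion.continuous_map

instance : StarRing S.Limit where
  star_involutive x := S.denseRange_toLimit.induction_on x
    (isClosed_eq (S.continuous_star_limit.comp S.continuous_star_limit) continuous_id)
    fun a => by rw [← toLimit_star, ← toLimit_star, star_star]
  star_mul x y := S.denseRange_toLimit.induction_on₂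
    (isClosed_eq (S.continuous_star_limit.comp continuous_mul)
      ((S.continuous_star_limit.comp continuous_snd).mul
        (S.continuous_star_limit.comp continuous_fst)))
    (fun a b => by
      rw [← toLimit_mul, ← toLimit_star, ← toLimit_star, ← toLimit_star, star_mul,
        toLimit_mul]) x y
  star_add x y := S.denseRange_toLimit.induction_on₂
    (isClosed_eq (S.continuous_star_limit.comp continuous_add)
      ((S.continuous_star_limit.comp continuous_fst).add
        (S.continuous_star_limit.comp continuous_snd)))
    (fun a b => by
      rw [← toLimit_add, ← toLimit_star, ← toLimit_star, ← toLimit_star, star_add,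
        toLimit_add]) x y

instance : CStarAlgebra S.Limit where
  norm_mul_self_le x := le_of_eq (S.denseRange_toLimit.induction_on x
    (isClosed_eq (continuous_norm.mul continuous_norm)
      (continuous_norm.comp (S.continuous_star_limit.mul continuous_id)))
    fun a => by
      rw [← toLimit_star, ← toLimit_mul, norm_toLimit, norm_toLimit,
        PreLimit.norm_star_mul_self])
  star_smul c x := S.denseRange_toLimit.induction_on x
    (isClosed_eq (S.continuous_star_limit.comp (continuous_const_smul c))
      ((continuous_const_smul (star c)).comp S.continuous_star_limit))
    fun a => by
      rw [← toLimit_smul, ← toLimit_star, ← toLimit_star, star_smul, toLimit_smul]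

end CStarSequence

/-- A tracial state on a unital C*-algebra: a positive unital (bounded) linear functional `τ`
with `τ (a b) = τ (b a)`. -/
structure IsTracialState {A : Type*} [CStarAlgebra A] (τ : A →L[ℂ] ℂ) : Prop where
  map_one : τ 1 = 1
  nonneg : ∀ a, 0 ≤ (τ (star a * a)).re ∧ (τ (star a * a)).im = 0
  trace : ∀ a b, τ (a * b) = τ (b * a)

/-- A C*-algebra is monotracial if it has exactly one tracial state. -/
def IsMonotracial (A : Type*) [CStarAlgebra A] : Prop :=
  ∃! τ : A →L[ℂ] ℂ, IsTracialState τ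

/-! ### Dimension drop algebras -/

open scoped Kronecker unitInterval

/-- The dimension drop algebra: continuous functions `f` from `[0,1]` to `M_p ⊗ M_q`, with
`f 0 ∈ M_p ⊗ 1` and `f 1 ∈ 1 ⊗ M_q`. Here `M_p ⊗ M_q` is the C*-algebra of matrices indexed by
`Fin p × Fin q`, and elementary tensors are Kronecker products. -/
def dimensionDrop (p q : ℕ) :
    StarSubalgebra ℂ C(I, Matrix (Fin p × Fin q) (Fin p × Fin q) ℂ) where
  carrier := {f | (∃ a : Matrix (Fin p) (Fin p) ℂ, f 0 = a ⊗ₖ (1 : Matrix (Fin q) (Fin q) ℂ)) ∧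
    ∃ b : Matrix (Fin q) (Fin q) ℂ, f 1 = (1 : Matrix (Fin p) (Fin p) ℂ) ⊗ₖ b}
  mul_mem' := by
    rintro f g ⟨⟨a, ha⟩, b, hb⟩ ⟨⟨a', ha'⟩, b', hb'⟩
    refine ⟨⟨a * a', ?_⟩, b * b', ?_⟩
    · rw [ContinuousMap.mul_apply, ha, ha', ← Matrix.mul_kronecker_mul, one_mul]
    · rw [ContinuousMap.mul_apply, hb, hb', ← Matrix.mul_kronecker_mul, one_mul]
  add_mem' := by
    rintro f g ⟨⟨a, ha⟩, b, hb⟩ ⟨⟨a', ha'⟩, b', hb'⟩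
    refine ⟨⟨a + a', ?_⟩, b + b', ?_⟩
    · rw [ContinuousMap.add_apply, ha, ha', Matrix.add_kronecker]
    · rw [ContinuousMap.add_apply, hb, hb', Matrix.kronecker_add]
  algebraMap_mem' c := by
    refine ⟨⟨c • 1, ?_⟩, c • 1, ?_⟩
    · rw [Matrix.smul_kronecker, Matrix.one_kronecker_one, Algebra.algebraMap_eq_smul_one]
      rfl
    · rw [Matrix.kronecker_smul, Matrix.one_kronecker_one, Algebra.algebraMap_eq_smul_one]
      rfl
  star_mem' := by
    rintro f ⟨⟨a, ha⟩, b, hb⟩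
    refine ⟨⟨star a, ?_⟩, star b, ?_⟩
    · rw [ContinuousMap.star_apply, ha]
      simp [Matrix.star_eq_conjTranspose, Matrix.conjTranspose_kronecker]
    · rw [ContinuousMap.star_apply, hb]
      simp [Matrix.star_eq_conjTranspose, Matrix.conjTranspose_kronecker]

instance dimensionDrop_isClosed (p q : ℕ) :
    IsClosed (dimensionDrop p q : Set C(I, Matrix (Fin p × Fin q) (Fin p × Fin q) ℂ)) := by
  let L : Matrix (Fin p) (Fin p) ℂ →ₗ[ℂ] Matrix (Fin p × Fin q) (Fin p × Fin q) ℂ :=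
    { toFun := fun a => a ⊗ₖ (1 : Matrix (Fin q) (Fin q) ℂ)
      map_add' := fun a b => Matrix.add_kronecker a b 1
      map_smul' := fun c a => Matrix.smul_kronecker c a 1 }
  let R : Matrix (Fin q) (Fin q) ℂ →ₗ[ℂ] Matrix (Fin p × Fin q) (Fin p × Fin q) ℂ :=
    { toFun := fun b => (1 : Matrix (Fin p) (Fin p) ℂ) ⊗ₖ b
      map_add' := fun a b => Matrix.kronecker_add 1 a b
      map_smul' := fun c b => Matrix.kronecker_smul c 1 b }
  have hL := (Submodule.closed_of_finiteDimensional (LinearMap.range L)).preimage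
    (continuous_eval_const (F := C(I, Matrix (Fin p × Fin q) (Fin p × Fin q) ℂ)) (0 : I))
  have hR := (Submodule.closed_of_finiteDimensional (LinearMap.range R)).preimage
    (continuous_eval_const (F := C(I, Matrix (Fin p × Fin q) (Fin p × Fin q) ℂ)) (1 : I))
  convert hL.inter hR using 1
  ext f
  constructor
  · rintro ⟨⟨a, ha⟩, b, hb⟩
    exact ⟨⟨a, ha.symm⟩, b, hb.symm⟩
  · rintro ⟨⟨a, ha⟩, b, hb⟩
    exact ⟨⟨a, ha.symm⟩, b, hb.symm⟩

/-- The C*-algebra `Z_{p,q}`, with the supremum of the operator norms as its norm. -/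
abbrev DimensionDrop (p q : ℕ) : Type := dimensionDrop p q

namespace DimensionDrop

variable {p q p' q' : ℕ}

/-- The matrix `c (f 0)`, that is, the matrix `a` with `f 0 = a ⊗ 1` (unique if `q ≠ 0`). -/
def left (f : DimensionDrop p q) : Matrix (Fin p) (Fin p) ℂ := f.2.1.choose

theorem left_spec (f : DimensionDrop p q) :
    f.1 0 = f.left ⊗ₖ (1 : Matrix (Fin q) (Fin q) ℂ) := f.2.1.choose_spec

/-- The matrix `c (f 1)`, that is, the matrix `b` with `f 1 = 1 ⊗ b` (unique if `p ≠ 0`). -/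
def right (f : DimensionDrop p q) : Matrix (Fin q) (Fin q) ℂ := f.2.2.choose

theorem right_spec (f : DimensionDrop p q) :
    f.1 1 = (1 : Matrix (Fin p) (Fin p) ℂ) ⊗ₖ f.right := f.2.2.choose_spec

/-- The block diagonal matrix
`diag [c (f 0), …, c (f 0), f (t₁), …, f (t_k), c (f 1), …, c (f 1)]`, in which `c (f 0)`
occurs `a` times and `c (f 1)` occurs `b` times. -/
def patternMatrix (a b : ℕ) {k : ℕ} (t : Fin k → I) (f : DimensionDrop p q) :
    Matrix ((Fin p × Fin a) ⊕ (((Fin p × Fin q) × Fin k) ⊕ (Fin q × Fin b)))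
      ((Fin p × Fin a) ⊕ (((Fin p × Fin q) × Fin k) ⊕ (Fin q × Fin b))) ℂ :=
  Matrix.fromBlocks (Matrix.blockDiagonal fun _ : Fin a => f.left) 0 0
    (Matrix.fromBlocks (Matrix.blockDiagonal fun i : Fin k => f.1 (t i)) 0 0
      (Matrix.blockDiagonal fun _ : Fin b => f.right))

/-- The continuous functions `t₁, …, t_k` from `[0,1]` to `[0,1]` form an eigenvalue pattern of
the unital `*`-homomorphism `φ : Z_{p,q} → Z_{p',q'}`: there are remainder indices
`0 ≤ a < q` and `0 ≤ b < p` and unitary matrices `v_s` of size `p' q'` (not assumed to depend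
continuously on `s`) with
`φ f s = v_s diag [c (f 0), …, f (t₁ s), …, f (t_k s), …, c (f 1)] v_s*`. The bijection `e`
identifies the two index sets of size `p' q'`; its choice is absorbed by `v_s`. -/
def IsEigenvaluePattern (φ : DimensionDrop p q →⋆ₐ[ℂ] DimensionDrop p' q') {k : ℕ}
    (t : Fin k → C(I, I)) : Prop :=
  ∃ a b : ℕ, a < q ∧ b < p ∧
    ∃ e : ((Fin p × Fin a) ⊕ (((Fin p × Fin q) × Fin k) ⊕ (Fin q × Fin b))) ≃ Fin p' × Fin q',
    ∃ v : I → Matrix.unitaryGroup (Fin p' × Fin q') ℂ, ∀ (f : DimensionDrop p q) (s : I),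
      (φ f).1 s = (v s : Matrix (Fin p' × Fin q') (Fin p' × Fin q') ℂ) *
        Matrix.reindex e e (patternMatrix a b (fun i => t i s) f) *
        star (v s : Matrix (Fin p' × Fin q') (Fin p' × Fin q') ℂ)

/-- An eigenvalue pattern is normalized if `t₁ ≤ … ≤ t_k` pointwise. -/
def IsNormalizedEigenvaluePattern (φ : DimensionDrop p q →⋆ₐ[ℂ] DimensionDrop p' q') {k : ℕ}
    (t : Fin k → C(I, I)) : Prop :=
  IsEigenvaluePattern φ t ∧ ∀ i j, i ≤ j → ∀ s, t i s ≤ t j s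

open Classical in
/-- The normalized eigenvalue pattern of `φ`, with its length. It exists and is unique whenever
`p, q ≥ 1`; the empty pattern is only a default value that completes the definition. -/
def normalizedPattern (φ : DimensionDrop p q →⋆ₐ[ℂ] DimensionDrop p' q') :
    Σ k : ℕ, Fin k → C(I, I) :=
  if h : ∃ P : Σ k : ℕ, Fin k → C(I, I), IsNormalizedEigenvaluePattern φ P.2 then h.choose
  else ⟨0, Fin.elim0⟩

/-- The number `k` of functions in the normalized eigenvalue pattern of `φ`. -/
def patternLength (φ : DimensionDrop p q →⋆ₐ[ℂ] DimensionDrop p' q') : ℕ :=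
  (normalizedPattern φ).1

/-- The function `t_i` of the normalized eigenvalue pattern of `φ`. -/
def eigenvalueFunction (φ : DimensionDrop p q →⋆ₐ[ℂ] DimensionDrop p' q')
    (i : Fin (patternLength φ)) : C(I, I) :=
  (normalizedPattern φ).2 i

/-- The number of indices `i` with `min t_i < y - ε` and `max t_i > y + ε`. Since `t_i` is
continuous on a compact interval, its infimum and supremum are attained. -/
def crossingNumber (φ : DimensionDrop p q →⋆ₐ[ℂ] DimensionDrop p' q') (y ε : ℝ) : ℕ :=
  Set.ncard {i : Fin (patternLength φ) |
    (⨅ s : I, (eigenvalueFunction φ i s : ℝ)) < y - ε ∧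
    y + ε < ⨆ s : I, (eigenvalueFunction φ i s : ℝ)}

end DimensionDrop

end

open scoped Kronecker unitInterval

noncomputable section

namespace DimensionDrop

variable {p q : ℕ}

/-! ### Elements and evaluations of dimension drop algebras -/

/-! Both conditions are equivalent to a third one: for every `m` and every `f` at level `m`, the
oscillation over `s ∈ [0,1]` of the normalized trace of `ι_{n,m} f` tends to `0` as `n → ∞`.

Link with traces: a tracial functional on `Z_{p,q}` sees only the pointwise trace (`tracial_eq`), so
at level `n` a tracial state is determined up to the oscillation of that trace
(`norm_tracial_sub_le`). If the oscillations vanish, every tracial state of the limit is the limit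
of the traces at `0`, hence there is at most one; an ultrafilter limit of point traces gives
existence. Conversely, if some oscillation stays at least `η` for infinitely many `n`, ultrafilter
limits of the traces at two families of bad points are two tracial states that differ
(`eventually_norm_normTrace_sub_lt_of_isMonotracial`).

Link with crossings: the pattern gives `tr (φ f) s = const + (pq / p'q') ∑ i, tr f (t_i s)`. A `t_i`
of small range moves `tr f` little, and a `t_i` of large range crosses one of finitely many grid
points, so small crossing ratios give small oscillation (`norm_normTrace_map_sub_le`). For the
converse, apply `φ` to a central ramp around `y`. Because the `t_i` are ordered, there are two
points `s`, `s'` between which all crossing functions rise through the ramp simultaneously and no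
other function falls along it (`exists_crossingNumber_le_sum`), so the crossings add up in one
difference of traces.

The pattern is defined by choice with a default, so its existence has to be proved. At each `s` the
representation `f ↦ φ f s` is split into irreducible blocks; coprimality makes the numbers of blocks
independent of `s`, and the sorted points are continuous because the traces of central elements are.
Uniqueness of the pattern is not needed: only its order and its trace formula enter. -/

theorem kronecker_one_injective (hq : 0 < q) : Function.Injective
    fun a : Matrix (Fin p) (Fin p) ℂ => a ⊗ₖ (1 : Matrix (Fin q) (Fin q) ℂ) := by
  intro a b h
  ext i j
  simpa [Matrix.kronecker_apply] using congrFun₂ h (i, ⟨0, hq⟩) (j, ⟨0, hq⟩)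

theorem one_kronecker_injective (hp : 0 < p) : Function.Injective
    fun b : Matrix (Fin q) (Fin q) ℂ => (1 : Matrix (Fin p) (Fin p) ℂ) ⊗ₖ b := by
  intro a b h
  ext i j
  simpa [Matrix.kronecker_apply] using congrFun₂ h (⟨0, hp⟩, i) (⟨0, hp⟩, j)

theorem left_eq (hq : 0 < q) {f : DimensionDrop p q} {a : Matrix (Fin p) (Fin p) ℂ}
    (h : f.1 0 = a ⊗ₖ (1 : Matrix (Fin q) (Fin q) ℂ)) : f.left = a :=
  kronecker_one_injective hq (f.left_spec.symm.trans h)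

theorem right_eq (hp : 0 < p) {f : DimensionDrop p q} {b : Matrix (Fin q) (Fin q) ℂ}
    (h : f.1 1 = (1 : Matrix (Fin p) (Fin p) ℂ) ⊗ₖ b) : f.right = b :=
  one_kronecker_injective hp (f.right_spec.symm.trans h)

/-- Evaluation at a point, as a `*`-homomorphism. -/
def evalAt (s : I) : DimensionDrop p q →⋆ₐ[ℂ] Matrix (Fin p × Fin q) (Fin p × Fin q) ℂ where
  toFun f := f.1 s
  map_one' := rfl
  map_mul' _ _ := rfl
  map_zero' := rfl
  map_add' _ _ := rfl
  commutes' _ := rfl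
  map_star' _ := rfl

@[simp] theorem evalAt_apply (s : I) (f : DimensionDrop p q) : evalAt s f = f.1 s := rfl

/-- The irreducible representation `f ↦ c (f 0)`. -/
def leftHom (hq : 0 < q) : DimensionDrop p q →⋆ₐ[ℂ] Matrix (Fin p) (Fin p) ℂ where
  toFun f := f.left
  map_one' := left_eq hq Matrix.one_kronecker_one.symm
  map_mul' f g := left_eq hq <| by
    have h := Matrix.mul_kronecker_mul f.left g.left (1 : Matrix (Fin q) (Fin q) ℂ)
      (1 : Matrix (Fin q) (Fin q) ℂ)
    rw [one_mul, ← left_spec, ← left_spec] at h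
    exact h.symm
  map_zero' := left_eq hq (Matrix.zero_kronecker _).symm
  map_add' f g := left_eq hq <| by rw [Matrix.add_kronecker, ← left_spec, ← left_spec]; rfl
  commutes' c := left_eq hq <| by
    rw [Algebra.algebraMap_eq_smul_one (A := Matrix (Fin p) (Fin p) ℂ), Matrix.smul_kronecker,
      Matrix.one_kronecker_one]
    exact Algebra.algebraMap_eq_smul_one c
  map_star' f := left_eq hq <| by
    rw [Matrix.star_eq_conjTranspose, ← Matrix.conjTranspose_one (n := Fin q),
      ← Matrix.conjTranspose_kronecker, ← left_spec]
    rfl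

@[simp] theorem leftHom_apply (hq : 0 < q) (f : DimensionDrop p q) : leftHom hq f = f.left := rfl

/-- The irreducible representation `f ↦ c (f 1)`. -/
def rightHom (hp : 0 < p) : DimensionDrop p q →⋆ₐ[ℂ] Matrix (Fin q) (Fin q) ℂ where
  toFun f := f.right
  map_one' := right_eq hp Matrix.one_kronecker_one.symm
  map_mul' f g := right_eq hp <| by
    have h := Matrix.mul_kronecker_mul (1 : Matrix (Fin p) (Fin p) ℂ)
      (1 : Matrix (Fin p) (Fin p) ℂ) f.right g.right
    rw [one_mul, ← right_spec, ← right_spec] at h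
    exact h.symm
  map_zero' := right_eq hp (Matrix.kronecker_zero _).symm
  map_add' f g := right_eq hp <| by rw [Matrix.kronecker_add, ← right_spec, ← right_spec]; rfl
  commutes' c := right_eq hp <| by
    rw [Algebra.algebraMap_eq_smul_one (A := Matrix (Fin q) (Fin q) ℂ), Matrix.kronecker_smul,
      Matrix.one_kronecker_one]
    exact Algebra.algebraMap_eq_smul_one c
  map_star' f := right_eq hp <| by
    rw [Matrix.star_eq_conjTranspose, ← Matrix.conjTranspose_one (n := Fin p),
      ← Matrix.conjTranspose_kronecker, ← right_spec]
    rfl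

@[simp] theorem rightHom_apply (hp : 0 < p) (f : DimensionDrop p q) :
    rightHom hp f = f.right := rfl

/-- The element `s ↦ g s • M`, when it satisfies the boundary conditions. -/
def elem (g : C(I, ℂ)) (M : Matrix (Fin p × Fin q) (Fin p × Fin q) ℂ)
    (h₀ : ∃ a : Matrix (Fin p) (Fin p) ℂ, g 0 • M = a ⊗ₖ (1 : Matrix (Fin q) (Fin q) ℂ))
    (h₁ : ∃ b : Matrix (Fin q) (Fin q) ℂ, g 1 • M = (1 : Matrix (Fin p) (Fin p) ℂ) ⊗ₖ b) :
    DimensionDrop p q :=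
  ⟨⟨fun s => g s • M, by fun_prop⟩, h₀, h₁⟩

@[simp] theorem elem_val_apply (g : C(I, ℂ)) (M : Matrix (Fin p × Fin q) (Fin p × Fin q) ℂ)
    (h₀ h₁) (s : I) : (elem g M h₀ h₁).1 s = g s • M := rfl

/-- The element `s ↦ g s • (a ⊗ 1)` for `g 1 = 0`. -/
def leftElem (g : C(I, ℂ)) (hg : g 1 = 0) (a : Matrix (Fin p) (Fin p) ℂ) : DimensionDrop p q :=
  elem g (a ⊗ₖ 1) ⟨g 0 • a, by rw [Matrix.smul_kronecker]⟩ ⟨0, by simp [hg]⟩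

/-- The element `s ↦ g s • (1 ⊗ b)` for `g 0 = 0`. -/
def rightElem (g : C(I, ℂ)) (hg : g 0 = 0) (b : Matrix (Fin q) (Fin q) ℂ) : DimensionDrop p q :=
  elem g (1 ⊗ₖ b) ⟨0, by simp [hg]⟩ ⟨g 1 • b, by rw [Matrix.kronecker_smul]⟩

/-- The element `s ↦ g s • M` for `g 0 = g 1 = 0`. -/
def midElem (g : C(I, ℂ)) (h₀ : g 0 = 0) (h₁ : g 1 = 0)
    (M : Matrix (Fin p × Fin q) (Fin p × Fin q) ℂ) : DimensionDrop p q :=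
  elem g M ⟨0, by simp [h₀]⟩ ⟨0, by simp [h₁]⟩

/-- The central element `s ↦ g s • 1`. -/
def scalar (g : C(I, ℂ)) : DimensionDrop p q :=
  elem g 1 ⟨g 0 • 1, by rw [Matrix.smul_kronecker, Matrix.one_kronecker_one]⟩
    ⟨g 1 • 1, by rw [Matrix.kronecker_smul, Matrix.one_kronecker_one]⟩

@[simp] theorem leftElem_val_apply (g : C(I, ℂ)) (hg) (a : Matrix (Fin p) (Fin p) ℂ) (s : I) :
    (leftElem (q := q) g hg a).1 s = g s • (a ⊗ₖ 1) := rfl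

@[simp] theorem rightElem_val_apply (g : C(I, ℂ)) (hg) (b : Matrix (Fin q) (Fin q) ℂ) (s : I) :
    (rightElem (p := p) g hg b).1 s = g s • (1 ⊗ₖ b) := rfl

@[simp] theorem midElem_val_apply (g : C(I, ℂ)) (h₀ h₁)
    (M : Matrix (Fin p × Fin q) (Fin p × Fin q) ℂ) (s : I) :
    (midElem g h₀ h₁ M).1 s = g s • M := rfl

@[simp] theorem scalar_val_apply (g : C(I, ℂ)) (s : I) :
    (scalar (p := p) (q := q) g).1 s = g s • 1 := rfl

theorem ext_apply {f g : DimensionDrop p q} (h : ∀ s, f.1 s = g.1 s) : f = g :=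
  Subtype.ext (ContinuousMap.ext h)

@[simp] theorem mul_val_apply (f g : DimensionDrop p q) (s : I) :
    (f * g).1 s = f.1 s * g.1 s := rfl

@[simp] theorem add_val_apply (f g : DimensionDrop p q) (s : I) :
    (f + g).1 s = f.1 s + g.1 s := rfl

@[simp] theorem sub_val_apply (f g : DimensionDrop p q) (s : I) :
    (f - g).1 s = f.1 s - g.1 s := rfl

@[simp] theorem one_val_apply (s : I) : (1 : DimensionDrop p q).1 s = 1 := rfl

@[simp] theorem smul_val_apply (c : ℂ) (f : DimensionDrop p q) (s : I) :
    (c • f).1 s = c • f.1 s := rfl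

theorem norm_le {f : DimensionDrop p q} {C : ℝ} (hC : 0 ≤ C) (h : ∀ s, ‖f.1 s‖ ≤ C) :
    ‖f‖ ≤ C :=
  (ContinuousMap.norm_le f.1 hC).2 h

theorem norm_apply_le (f : DimensionDrop p q) (s : I) : ‖f.1 s‖ ≤ ‖f‖ :=
  ContinuousMap.norm_coe_le_norm f.1 s

theorem leftHom_surjective (hq : 0 < q) : Function.Surjective (leftHom (p := p) hq) := by
  intro a
  refine ⟨leftElem ⟨fun s => 1 - (s : ℝ), by fun_prop⟩ (by simp) a, left_eq hq ?_⟩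
  simp

theorem rightHom_surjective (hp : 0 < p) : Function.Surjective (rightHom (q := q) hp) := by
  intro b
  refine ⟨rightElem ⟨fun s => (s : ℝ), by fun_prop⟩ (by simp) b, right_eq hp ?_⟩
  simp

theorem evalAt_surjective {s : I} (h₀ : s ≠ 0) (h₁ : s ≠ 1) :
    Function.Surjective (evalAt (p := p) (q := q) s) := by
  intro M
  have h₀' : ((s : ℝ) : ℂ) ≠ 0 := fun h => h₀ (Subtype.ext (by exact_mod_cast h))
  have h₁' : (1 : ℂ) - ((s : ℝ) : ℂ) ≠ 0 := by
    rw [sub_ne_zero]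
    intro h
    exact h₁ (Subtype.ext (by exact_mod_cast h.symm))
  refine ⟨midElem ⟨fun t => (t : ℝ) * (1 - (t : ℝ)) / ((s : ℝ) * (1 - (s : ℝ))), by fun_prop⟩
    (by simp) (by simp) M, ?_⟩
  simp [h₀', h₁', div_self]

end DimensionDrop

namespace DimensionDrop

/-! ### Finite-dimensional representations -/

section Representations

variable {p q : ℕ} {V : Type*} [NormedAddCommGroup V] [InnerProductSpace ℂ V]
  [CompleteSpace V]

/-- The identity function on `[0,1]`, as a central element. -/
def coord : DimensionDrop p q := scalar ⟨fun t => ((t : ℝ) : ℂ), by fun_prop⟩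

@[simp] theorem coord_val_apply (t : I) :
    (coord (p := p) (q := q)).1 t = ((t : ℝ) : ℂ) • 1 := rfl

theorem norm_map_le (π : DimensionDrop p q →⋆ₐ[ℂ] (V →L[ℂ] V)) (f : DimensionDrop p q) :
    ‖π f‖ ≤ ‖f‖ :=
  NonUnitalStarAlgHom.norm_apply_le (F := DimensionDrop p q →⋆ₐ[ℂ] (V →L[ℂ] V)) π f

/-- A vector on which the coordinate function acts as multiplication by `s` is annihilated by
all elements that vanish at `s`. -/
theorem map_apply_eq_zero_of_val_eq_zero (π : DimensionDrop p q →⋆ₐ[ℂ] (V →L[ℂ] V)) {s : I}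
    {v : V} (hv : π coord v = ((s : ℝ) : ℂ) • v) {f : DimensionDrop p q} (hf : f.1 s = 0) :
    π f v = 0 := by
  set d : DimensionDrop p q := coord - algebraMap ℂ _ ((s : ℝ) : ℂ) with hd
  have hdv : π d v = 0 := by
    rw [hd, map_sub π, AlgHomClass.commutes, sub_apply, hv,
      Algebra.algebraMap_eq_smul_one]
    simp
  -- `w` is `1 - (t - s)²`: it fixes `v`, and its powers concentrate at `s`, so `f * w ^ n` is small
  -- in norm while `π (f * w ^ n) v = π f v`.
  set w : DimensionDrop p q := 1 - d * d with hw
  have hwv : π w v = v := by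
    rw [hw, map_sub π, map_one, map_mul]
    simp [hdv]
  have hwn : ∀ n : ℕ, π (w ^ n) v = v := by
    intro n
    induction n with
    | zero => simp
    | succ n ih => rw [pow_succ, map_mul, mul_apply_eq_comp, hwv, ih]
  have hdt : ∀ t : I, d.1 t = (((t : ℝ) - (s : ℝ) : ℝ) : ℂ) • 1 := fun t => by
    rw [hd, sub_val_apply, coord_val_apply, Complex.ofReal_sub, sub_smul,
      Algebra.algebraMap_eq_smul_one, smul_val_apply, one_val_apply]
  have hwt : ∀ (n : ℕ) (t : I),
      (w ^ n).1 t = (((1 - ((t : ℝ) - s) ^ 2) ^ n : ℝ) : ℂ) • 1 := by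
    intro n t
    have h1 : w.1 t = ((1 - ((t : ℝ) - s) ^ 2 : ℝ) : ℂ) • 1 := by
      rw [hw, sub_val_apply, mul_val_apply, hdt, one_val_apply, smul_mul_smul_comm, one_mul]
      push_cast
      rw [sub_smul, one_smul, sq]
    change (w.1 ^ n) t = _
    rw [ContinuousMap.pow_apply, h1, smul_pow, one_pow, Complex.ofReal_pow]
  refine norm_le_zero_iff.1 (le_of_forall_pos_le_add fun ε hε => ?_)
  obtain ⟨η, hη, hηε⟩ : ∃ η > 0, η * ‖v‖ ≤ ε :=
    ⟨ε / (‖v‖ + 1), by positivity, by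
      rw [div_mul_eq_mul_div, div_le_iff₀ (by positivity)]; nlinarith [norm_nonneg v]⟩
  obtain ⟨δ, hδ, hδf⟩ := Metric.continuousAt_iff.1 (f.1.continuous.continuousAt (x := s)) η hη
  -- Within `δ` of `s` the element `f` is small and `w ^ n ≤ 1`; elsewhere `w ≤ 1 - r²`. The minimum
  -- with `1` keeps `1 - r²` nonnegative.
  set r := min δ 1 with hr
  have hr0 : 0 < r := lt_min hδ one_pos
  have hr1 : r ≤ 1 := min_le_right _ _
  obtain ⟨n, hn⟩ := exists_pow_lt_of_lt_one (show 0 < η / (‖f‖ + 1) by positivity)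
    (show 1 - r ^ 2 < 1 by nlinarith)
  have hnorm : ‖f * w ^ n‖ ≤ η := by
    refine norm_le hη.le fun t => ?_
    have hts : |(t : ℝ) - s| ≤ 1 := by
      rw [abs_le]; constructor <;> linarith [t.2.1, t.2.2, s.2.1, s.2.2]
    have hts2 : ((t : ℝ) - s) ^ 2 ≤ 1 := by rw [← sq_abs]; nlinarith [abs_nonneg ((t : ℝ) - s)]
    have hb0 : 0 ≤ 1 - ((t : ℝ) - s) ^ 2 := by linarith
    rw [mul_val_apply, hwt, mul_smul_comm, mul_one, norm_smul, Complex.norm_real, norm_pow,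
      Real.norm_of_nonneg hb0]
    rcases lt_or_ge (dist t s) δ with h | h
    · have h2 := hδf h
      rw [hf, dist_zero_right] at h2
      calc _ ≤ 1 * ‖f.1 t‖ := by
            gcongr
            exact pow_le_one₀ hb0 (by nlinarith [sq_nonneg ((t : ℝ) - s)])
        _ ≤ η := by rw [one_mul]; exact h2.le
    · have h3 : r ^ 2 ≤ ((t : ℝ) - s) ^ 2 := by
        rw [← sq_abs ((t : ℝ) - s)]
        have : r ≤ |(t : ℝ) - s| := (min_le_left _ _).trans h
        gcongr
      calc _ ≤ (1 - r ^ 2) ^ n * ‖f‖ := by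
            refine mul_le_mul (pow_le_pow_left₀ hb0 (by linarith) n) (norm_apply_le f t)
              (norm_nonneg _) (pow_nonneg (by nlinarith) n)
        _ ≤ η / (‖f‖ + 1) * (‖f‖ + 1) := by
            gcongr
            linarith
        _ = η := by field_simp
  calc ‖π f v‖ = ‖π (f * w ^ n) v‖ := by
        rw [map_mul, mul_apply_eq_comp, hwn]
    _ ≤ ‖π (f * w ^ n)‖ * ‖v‖ := ContinuousLinearMap.le_opNorm _ _
    _ ≤ η * ‖v‖ := by
        gcongr
        exact (norm_map_le π _).trans hnorm
    _ ≤ 0 + ε := by linarith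

/-- A nonzero invariant subspace contains an eigenvector of the coordinate function, with an
eigenvalue in `[0,1]`. -/
theorem exists_eigenvector [FiniteDimensional ℂ V] (π : DimensionDrop p q →⋆ₐ[ℂ] (V →L[ℂ] V)) {U : Submodule ℂ V}
    (hU : U ≠ ⊥) (hinv : ∀ f, ∀ u ∈ U, π f u ∈ U) :
    ∃ (s : I) (v : V), v ∈ U ∧ v ≠ 0 ∧ π coord v = ((s : ℝ) : ℂ) • v := by
  have : Nontrivial U := Submodule.nontrivial_iff_ne_bot.2 hU
  obtain ⟨c, hc⟩ := Module.End.exists_eigenvalue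
    ((π coord : V →ₗ[ℂ] V).restrict (hinv coord))
  obtain ⟨⟨v, hvU⟩, hv⟩ := hc.exists_hasEigenvector
  have hv0 : v ≠ 0 := fun h => hv.2 (Subtype.ext h)
  have hv1 : π coord v = c • v := congrArg Subtype.val hv.apply_eq_smul
  by_cases h : ∃ s : I, ((s : ℝ) : ℂ) = c
  · obtain ⟨s, rfl⟩ := h
    exact ⟨s, v, hvU, hv0, hv1⟩
  · push Not at h
    exfalso
    -- An eigenvalue outside `[0,1]` is impossible, since `coord - c` is then invertible in the
    -- algebra but annihilates `v`.
    have h' : ∀ s : I, ((s : ℝ) : ℂ) - c ≠ 0 := fun s => sub_ne_zero.2 (h s)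
    set g : C(I, ℂ) := ⟨fun s => (((s : ℝ) : ℂ) - c)⁻¹,
      Continuous.inv₀ (by fun_prop) h'⟩
    have e : scalar g * (coord - algebraMap ℂ _ c) = (1 : DimensionDrop p q) := by
      refine ext_apply fun s => ?_
      rw [mul_val_apply, sub_val_apply, coord_val_apply, scalar_val_apply,
        Algebra.algebraMap_eq_smul_one, smul_val_apply, one_val_apply, ← sub_smul,
        smul_mul_smul_comm, one_mul, show g s = (((s : ℝ) : ℂ) - c)⁻¹ from rfl,
        inv_mul_cancel₀ (h' s), one_smul]
    have h2 : π (scalar g * (coord - algebraMap ℂ _ c)) v = v := by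
      rw [e, map_one]; rfl
    refine hv0 ?_
    rw [← h2, map_mul, mul_apply_eq_comp, map_sub π, AlgHomClass.commutes,
      sub_apply, hv1, Algebra.algebraMap_eq_smul_one]
    simp


/-- Matrix units transport a vector to an orthonormal family that spans an irreducible
subrepresentation. -/
theorem exists_orthonormal_of_surjective {ι : Type*} [Fintype ι] [DecidableEq ι]
    (π : DimensionDrop p q →⋆ₐ[ℂ] (V →L[ℂ] V))
    (ev : DimensionDrop p q →⋆ₐ[ℂ] Matrix ι ι ℂ) (hev : Function.Surjective ev)
    {U : Submodule ℂ V} (hinv : ∀ f, ∀ u ∈ U, π f u ∈ U) {v : V} (hvU : v ∈ U) (hv : v ≠ 0)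
    (hker : ∀ f, ev f = 0 → π f v = 0) :
    ∃ x : ι → V, Orthonormal ℂ x ∧ (∀ i, x i ∈ U) ∧
      ∀ f j, π f (x j) = ∑ i, ev f i j • x i := by
  -- On `v`, identities need only hold after `ev`; the lifts `F i j` of the matrix units may
  -- therefore be used as if they were matrix units.
  have hcongr : ∀ f g, ev f = ev g → π f v = π g v := fun f g h => by
    rw [← sub_eq_zero, ← sub_apply, ← map_sub π]
    exact hker _ (by rw [map_sub, h, sub_self])
  choose F hF using fun i j : ι => hev (Matrix.single i j 1)
  obtain ⟨i₀, hi₀⟩ : ∃ i, π (F i i) v ≠ 0 := by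
    by_contra! h
    refine hv ?_
    have : π 1 v = π (∑ i, F i i) v := hcongr _ _ (by
      rw [map_one, map_sum]
      simp_rw [hF]
      exact (Matrix.sum_single_one).symm)
    rw [map_one, one_apply_eq_self, map_sum, sum_apply] at this
    rw [this]
    exact Finset.sum_eq_zero fun i _ => h i
  set c : ℂ := ((‖π (F i₀ i₀) v‖⁻¹ : ℝ) : ℂ) with hc
  have hmove : ∀ f j, π f (π (F j i₀) v) = ∑ i, ev f i j • π (F i i₀) v := by
    intro f j
    rw [← mul_apply_eq_comp, ← map_mul]
    have : ev (f * F j i₀) = ev (∑ i, ev f i j • F i i₀) := by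
      rw [map_mul, map_sum, hF]
      simp_rw [map_smul, hF]
      ext k l
      rw [Matrix.sum_apply]
      by_cases hl : i₀ = l
      · subst hl
        simp [Matrix.single_apply]
      · rw [Matrix.mul_single_apply_of_ne _ _ _ _ _ (Ne.symm hl)]
        simp [hl]
    rw [hcongr _ _ this, map_sum, sum_apply]
    simp
  refine ⟨fun j => c • π (F j i₀) v, ?_, fun i => U.smul_mem _ (hinv _ _ hvU), fun f j => ?_⟩
  · have hinner : ∀ j l, inner ℂ (π (F j i₀) v) (π (F l i₀) v) =
        if j = l then ((‖π (F i₀ i₀) v‖ : ℂ)) ^ 2 else 0 := by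
      -- `star (F j i₀) * F l i₀` maps to `δ_{jl}` times the matrix unit at `(i₀, i₀)`. So the
      -- vectors are orthogonal with a common norm, that of `π (F i₀ i₀) v`, which is what `c`
      -- normalizes.
      have key : ∀ j l, inner ℂ (π (F j i₀) v) (π (F l i₀) v) =
          if j = l then inner ℂ v (π (F i₀ i₀) v) else 0 := by
        intro j l
        have h1 : inner ℂ (π (F j i₀) v) (π (F l i₀) v) =
            inner ℂ v (π (star (F j i₀) * F l i₀) v) := by
          rw [map_mul, map_star, mul_apply_eq_comp,
            ContinuousLinearMap.star_eq_adjoint, ContinuousLinearMap.adjoint_inner_right]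
        rw [h1]
        split_ifs with h
        · subst h
          rw [hcongr _ (F i₀ i₀)]
          rw [map_mul, map_star, hF, hF, Matrix.star_eq_conjTranspose]
          simp
        · rw [hker _ (by
            rw [map_mul, map_star, hF, hF, Matrix.star_eq_conjTranspose]
            simp [h]), inner_zero_right]
      intro j l
      rw [key]
      split_ifs with h
      · have := key i₀ i₀
        rw [if_pos rfl] at this
        rw [← this, inner_self_eq_norm_sq_to_K]
        rfl
      · rfl
    rw [orthonormal_iff_ite]
    intro j l
    rw [inner_smul_left, inner_smul_right, hinner]
    have hne : ((‖π (F i₀ i₀) v‖ : ℝ) : ℂ) ≠ 0 := by exact_mod_cast norm_ne_zero_iff.2 hi₀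
    split_ifs
    · rw [hc, Complex.conj_ofReal]
      push_cast
      field_simp
    · simp
  · rw [map_smul, hmove, Finset.smul_sum]
    exact Finset.sum_congr rfl fun i _ => smul_comm _ _ _

end Representations

end DimensionDrop

namespace DimensionDrop

/-! ### Orthonormal families that realize an eigenvalue pattern -/

section Families

variable {p q : ℕ} {V : Type*} [NormedAddCommGroup V] [InnerProductSpace ℂ V]
  [CompleteSpace V] {α β κ : Type}

/-- An orthonormal family of vectors on which `f` acts as the block diagonal matrix with blocks
`c (f 0)` (indexed by `α`), `f (t c)` (indexed by `c : κ`) and `c (f 1)` (indexed by `β`). -/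
structure IsPatternFamily (π : DimensionDrop p q →⋆ₐ[ℂ] (V →L[ℂ] V)) (t : κ → I)
    (x : (Fin p × α) ⊕ (((Fin p × Fin q) × κ) ⊕ (Fin q × β)) → V) : Prop where
  orthonormal : Orthonormal ℂ x
  left : ∀ f c j, π f (x (.inl (j, c))) = ∑ i, f.left i j • x (.inl (i, c))
  mid : ∀ f c j, π f (x (.inr (.inl (j, c)))) = ∑ i, f.1 (t c) i j • x (.inr (.inl (i, c)))
  right : ∀ f c j, π f (x (.inr (.inr (j, c)))) = ∑ i, f.right i j • x (.inr (.inr (i, c)))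

variable {π : DimensionDrop p q →⋆ₐ[ℂ] (V →L[ℂ] V)} {t : κ → I}
  {x : (Fin p × α) ⊕ (((Fin p × Fin q) × κ) ⊕ (Fin q × β)) → V}

theorem IsPatternFamily.reindex (h : IsPatternFamily π t x) {α' β' κ' : Type} (eα : α' ≃ α)
    (eβ : β' ≃ β) (eκ : κ' ≃ κ) : IsPatternFamily π (t ∘ eκ)
      (x ∘ Sum.map (Prod.map id eα) (Sum.map (Prod.map id eκ) (Prod.map id eβ))) where
  orthonormal := h.orthonormal.comp _ <| by
    refine Sum.map_injective.2 ⟨?_, Sum.map_injective.2 ⟨?_, ?_⟩⟩ <;>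
    exact Function.injective_id.prodMap (Equiv.injective _)
  left f c j := h.left f (eα c) j
  mid f c j := h.mid f (eκ c) j
  right f c j := h.right f (eβ c) j

theorem orthonormal_sumElim {E ι ι' : Type*} [NormedAddCommGroup E] [InnerProductSpace ℂ E]
    {x : ι → E} {y : ι' → E} (hx : Orthonormal ℂ x)
    (hy : Orthonormal ℂ y) (hxy : ∀ i, y i ∈ (Submodule.span ℂ (Set.range x))ᗮ) :
    Orthonormal ℂ (Sum.elim x y) := by
  have h0 : ∀ i j, inner ℂ (x i) (y j) = 0 := fun i j =>
    (Submodule.mem_orthogonal _ _).1 (hxy j) _ (Submodule.subset_span ⟨i, rfl⟩)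
  refine ⟨?_, ?_⟩
  · rintro (i | i)
    · exact hx.1 i
    · exact hy.1 i
  · rintro (i | i) (j | j) hij
    · exact hx.2 fun h => hij (congrArg _ h)
    · exact h0 i j
    · exact inner_eq_zero_symm.1 (h0 j i)
    · exact hy.2 fun h => hij (congrArg _ h)

/-- An irreducible block found orthogonally to the family is appended as the new copy `none`; the
two analogues below do the same for the other kinds of blocks. -/
theorem IsPatternFamily.extend_left (h : IsPatternFamily π t x) {y : Fin p → V}
    (hy : Orthonormal ℂ y) (hxy : ∀ i, y i ∈ (Submodule.span ℂ (Set.range x))ᗮ)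
    (hπ : ∀ f j, π f (y j) = ∑ i, f.left i j • y i) :
    ∃ x' : (Fin p × Option α) ⊕ (((Fin p × Fin q) × κ) ⊕ (Fin q × β)) → V,
      IsPatternFamily π t x' := by
  refine ⟨Sum.elim x y ∘ Sum.elim
    (fun ic => ic.2.elim (.inr ic.1) fun c => .inl (.inl (ic.1, c))) (fun w => .inl (.inr w)),
    (orthonormal_sumElim h.orthonormal hy hxy).comp _ ?_, ?_, h.mid, h.right⟩
  · rintro (⟨i, _ | c⟩ | w) (⟨j, _ | d⟩ | z) hij <;> simp_all
  · rintro f (_ | c) j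
    · exact hπ f j
    · exact h.left f c j

theorem IsPatternFamily.extend_mid (h : IsPatternFamily π t x) {y : Fin p × Fin q → V} {s : I}
    (hy : Orthonormal ℂ y) (hxy : ∀ i, y i ∈ (Submodule.span ℂ (Set.range x))ᗮ)
    (hπ : ∀ f j, π f (y j) = ∑ i, f.1 s i j • y i) :
    ∃ (t' : Option κ → I)
      (x' : (Fin p × α) ⊕ (((Fin p × Fin q) × Option κ) ⊕ (Fin q × β)) → V),
      IsPatternFamily π t' x' := by
  refine ⟨fun c => c.elim s t, Sum.elim x y ∘ Sum.elim (fun w => .inl (.inl w)) (Sum.elim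
    (fun ic => ic.2.elim (.inr ic.1) fun c => .inl (.inr (.inl (ic.1, c))))
    (fun w => .inl (.inr (.inr w)))),
    (orthonormal_sumElim h.orthonormal hy hxy).comp _ ?_, h.left, ?_, h.right⟩
  · rintro (w | ⟨i, _ | c⟩ | w) (z | ⟨j, _ | d⟩ | z) hij <;> simp_all
  · rintro f (_ | c) j
    · exact hπ f j
    · exact h.mid f c j

theorem IsPatternFamily.extend_right (h : IsPatternFamily π t x) {y : Fin q → V}
    (hy : Orthonormal ℂ y) (hxy : ∀ i, y i ∈ (Submodule.span ℂ (Set.range x))ᗮ)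
    (hπ : ∀ f j, π f (y j) = ∑ i, f.right i j • y i) :
    ∃ x' : (Fin p × α) ⊕ (((Fin p × Fin q) × κ) ⊕ (Fin q × Option β)) → V,
      IsPatternFamily π t x' := by
  refine ⟨Sum.elim x y ∘ Sum.elim (fun w => .inl (.inl w)) (Sum.elim
    (fun w => .inl (.inr (.inl w)))
    (fun ic => ic.2.elim (.inr ic.1) fun c => .inl (.inr (.inr (ic.1, c))))),
    (orthonormal_sumElim h.orthonormal hy hxy).comp _ ?_, h.left, h.mid, ?_⟩
  · rintro (w | w | ⟨i, _ | c⟩) (z | z | ⟨j, _ | d⟩) hij <;> simp_all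
  · rintro f (_ | c) j
    · exact hπ f j
    · exact h.right f c j

/-- `q` blocks `c (f 0)` form a block `f 0`. -/
theorem IsPatternFamily.merge_left
    {x : (Fin p × (α ⊕ Fin q)) ⊕ (((Fin p × Fin q) × κ) ⊕ (Fin q × β)) → V}
    (h : IsPatternFamily π t x) :
    ∃ (t' : Option κ → I)
      (x' : (Fin p × α) ⊕ (((Fin p × Fin q) × Option κ) ⊕ (Fin q × β)) → V),
      IsPatternFamily π t' x' := by
  refine ⟨fun c => c.elim 0 t, x ∘ Sum.elim (fun w => .inl (w.1, .inl w.2)) (Sum.elim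
    (fun ic => ic.2.elim (.inl (ic.1.1, .inr ic.1.2)) fun c => .inr (.inl (ic.1, c)))
    (fun w => .inr (.inr w))),
    h.orthonormal.comp _ ?_, fun f c j => h.left f (.inl c) j, ?_, h.right⟩
  · rintro (w | ⟨⟨i, i'⟩, _ | c⟩ | w) (z | ⟨⟨j, j'⟩, _ | d⟩ | z) hij <;>
      simp_all [Prod.ext_iff]
  · rintro f (_ | c) ⟨j, j'⟩
    · refine (h.left f (.inr j') j).trans ?_
      rw [Fintype.sum_prod_type]
      refine Finset.sum_congr rfl fun i _ => ?_
      simp only [Option.elim, f.left_spec, Matrix.kronecker_apply, Matrix.one_apply,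
        Function.comp_apply, Sum.elim_inr, Sum.elim_inl, mul_ite, mul_one, mul_zero, ite_smul,
        zero_smul, Finset.sum_ite_eq', Finset.mem_univ, if_true]
    · exact h.mid f c (j, j')

/-- `p` blocks `c (f 1)` form a block `f 1`. -/
theorem IsPatternFamily.merge_right
    {x : (Fin p × α) ⊕ (((Fin p × Fin q) × κ) ⊕ (Fin q × (β ⊕ Fin p))) → V}
    (h : IsPatternFamily π t x) :
    ∃ (t' : Option κ → I)
      (x' : (Fin p × α) ⊕ (((Fin p × Fin q) × Option κ) ⊕ (Fin q × β)) → V),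
      IsPatternFamily π t' x' := by
  refine ⟨fun c => c.elim 1 t, x ∘ Sum.elim Sum.inl (Sum.elim
    -- The copy number of the block becomes the first tensor index, because `f 1 = 1 ⊗ c (f 1)`; for
    -- blocks `c (f 0)` it becomes the second.
    (fun ic => ic.2.elim (.inr (.inr (ic.1.2, .inr ic.1.1))) fun c => .inr (.inl (ic.1, c)))
    (fun w => .inr (.inr (w.1, .inl w.2)))),
    h.orthonormal.comp _ ?_, h.left, ?_, fun f c j => h.right f (.inl c) j⟩
  · rintro (w | ⟨⟨i, i'⟩, _ | c⟩ | w) (z | ⟨⟨j, j'⟩, _ | d⟩ | z) hij <;>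
      simp_all [Prod.ext_iff]
  · rintro f (_ | c) ⟨j, j'⟩
    · refine (h.right f (.inr j) j').trans ?_
      rw [Fintype.sum_prod_type, Finset.sum_comm]
      refine Finset.sum_congr rfl fun i _ => ?_
      simp only [Option.elim, f.right_spec, Matrix.kronecker_apply, Matrix.one_apply,
        Function.comp_apply, Sum.elim_inr, Sum.elim_inl, ite_mul, one_mul, zero_mul, ite_smul,
        zero_smul, Finset.sum_ite_eq', Finset.mem_univ, if_true]
    · exact h.mid f c (j, j')

/-- `π` contains a subrepresentation with `a` blocks `c (f 0)`, `k` blocks `f (t i)` and `b`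
blocks `c (f 1)`. -/
def HasPatternFamily (π : DimensionDrop p q →⋆ₐ[ℂ] (V →L[ℂ] V)) (a b k : ℕ) : Prop :=
  ∃ (t : Fin k → I) (x : (Fin p × Fin a) ⊕ (((Fin p × Fin q) × Fin k) ⊕ (Fin q × Fin b)) → V),
    IsPatternFamily π t x

theorem IsPatternFamily.hasPatternFamily [Fintype α] [Fintype β] [Fintype κ]
    (h : IsPatternFamily π t x) {a b k : ℕ} (ha : Fintype.card α = a) (hb : Fintype.card β = b)
    (hk : Fintype.card κ = k) : HasPatternFamily π a b k :=
  ⟨_, _, h.reindex (Fintype.equivFinOfCardEq ha).symm (Fintype.equivFinOfCardEq hb).symm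
    (Fintype.equivFinOfCardEq hk).symm⟩

theorem hasPatternFamily_zero : HasPatternFamily π 0 0 0 := by
  have h : IsEmpty ((Fin p × Fin 0) ⊕ (((Fin p × Fin q) × Fin 0) ⊕ (Fin q × Fin 0))) :=
    inferInstance
  exact ⟨Fin.elim0, h.elim, ⟨fun i => h.elim i, fun i => h.elim i⟩, fun _ c => c.elim0,
    fun _ c => c.elim0, fun _ c => c.elim0⟩

/-- The orthogonal complement of a pattern family is invariant. -/
theorem IsPatternFamily.map_mem_orthogonal (h : IsPatternFamily π t x)
    (f : DimensionDrop p q) {u : V} (hu : u ∈ (Submodule.span ℂ (Set.range x))ᗮ) :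
    π f u ∈ (Submodule.span ℂ (Set.range x))ᗮ := by
  have hx : ∀ g j, π g (x j) ∈ Submodule.span ℂ (Set.range x) := by
    have hmem : ∀ j, x j ∈ Submodule.span ℂ (Set.range x) := fun j =>
      Submodule.subset_span ⟨j, rfl⟩
    rintro g (⟨j, c⟩ | ⟨j, c⟩ | ⟨j, c⟩)
    · rw [h.left]; exact Submodule.sum_mem _ fun i _ => Submodule.smul_mem _ _ (hmem _)
    · rw [h.mid]; exact Submodule.sum_mem _ fun i _ => Submodule.smul_mem _ _ (hmem _)
    · rw [h.right]; exact Submodule.sum_mem _ fun i _ => Submodule.smul_mem _ _ (hmem _)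
  have hspan : ∀ w ∈ Submodule.span ℂ (Set.range x), ∀ g,
      π g w ∈ Submodule.span ℂ (Set.range x) := fun w hw g => by
    have : Submodule.span ℂ (Set.range x) ≤
        (Submodule.span ℂ (Set.range x)).comap (π g : V →ₗ[ℂ] V) :=
      Submodule.span_le.2 (by rintro _ ⟨j, rfl⟩; exact hx g j)
    exact this hw
  rw [Submodule.mem_orthogonal] at hu ⊢
  intro w hw
  -- The adjoint of `π f` is `π (star f)`, which preserves the span.
  rw [← ContinuousLinearMap.adjoint_inner_left, ← ContinuousLinearMap.star_eq_adjoint,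
    ← map_star]
  exact hu _ (hspan w hw _)

/-- A family that is too small has a nonzero invariant orthogonal complement, which contains an
eigenvector of `coord` with eigenvalue some `s`. On it the action factors through the value at `s`,
so it generates a block of the kind given by `s = 0`, `s = 1` or `s` interior. -/
theorem HasPatternFamily.extend [FiniteDimensional ℂ V] (hp : 0 < p) (hq : 0 < q) {a b k : ℕ}
    (h : HasPatternFamily π a b k) (hlt : p * a + (p * q * k + q * b) < Module.finrank ℂ V) :
    HasPatternFamily π (a + 1) b k ∨ HasPatternFamily π a (b + 1) k ∨
      HasPatternFamily π a b (k + 1) := by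
  obtain ⟨t, x, h⟩ := h
  set U := (Submodule.span ℂ (Set.range x))ᗮ with hU
  have hU0 : U ≠ ⊥ := by
    intro h0
    rw [hU, Submodule.orthogonal_eq_bot_iff] at h0
    have h1 := finrank_range_le_card (R := ℂ) x
    rw [Set.finrank, h0, finrank_top] at h1
    simp at h1
    omega
  have hinv : ∀ f, ∀ u ∈ U, π f u ∈ U := fun f u hu => h.map_mem_orthogonal f hu
  obtain ⟨s, v, hvU, hv0, hv⟩ := exists_eigenvector π hU0 hinv
  have hker : ∀ f : DimensionDrop p q, f.1 s = 0 → π f v = 0 := fun f hf =>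
    map_apply_eq_zero_of_val_eq_zero π hv hf
  by_cases h0 : s = 0
  · subst h0
    obtain ⟨y, hy, hyU, hπ⟩ := exists_orthonormal_of_surjective π (leftHom hq)
      (leftHom_surjective hq) hinv hvU hv0 fun f hf => hker f <| by
        rw [left_spec, show f.left = 0 from hf, Matrix.zero_kronecker]
    obtain ⟨x', h'⟩ := h.extend_left hy hyU hπ
    exact .inl (h'.hasPatternFamily (by simp) (by simp) (by simp))
  by_cases h1 : s = 1
  · subst h1
    obtain ⟨y, hy, hyU, hπ⟩ := exists_orthonormal_of_surjective π (rightHom hp)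
      (rightHom_surjective hp) hinv hvU hv0 fun f hf => hker f <| by
        rw [right_spec, show f.right = 0 from hf, Matrix.kronecker_zero]
    obtain ⟨x', h'⟩ := h.extend_right hy hyU hπ
    exact .inr (.inl (h'.hasPatternFamily (by simp) (by simp) (by simp)))
  · obtain ⟨y, hy, hyU, hπ⟩ := exists_orthonormal_of_surjective π (evalAt s)
      (evalAt_surjective h0 h1) hinv hvU hv0 hker
    obtain ⟨t', x', h'⟩ := h.extend_mid (s := s) hy hyU hπ
    exact .inr (.inr (h'.hasPatternFamily (by simp) (by simp) (by simp)))

theorem HasPatternFamily.merge_left {a b k : ℕ} (h : HasPatternFamily π (a + q) b k) :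
    HasPatternFamily π a b (k + 1) := by
  obtain ⟨t, x, h⟩ := h
  obtain ⟨t', x', h'⟩ :=
    (h.reindex finSumFinEquiv (Equiv.refl _) (Equiv.refl _)).merge_left
  exact h'.hasPatternFamily (by simp) (by simp) (by simp)

theorem HasPatternFamily.merge_right {a b k : ℕ} (h : HasPatternFamily π a (b + p) k) :
    HasPatternFamily π a b (k + 1) := by
  obtain ⟨t, x, h⟩ := h
  obtain ⟨t', x', h'⟩ :=
    (h.reindex (Equiv.refl _) finSumFinEquiv (Equiv.refl _)).merge_right
  exact h'.hasPatternFamily (by simp) (by simp) (by simp)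

theorem HasPatternFamily.card_le [FiniteDimensional ℂ V] {a b k : ℕ}
    (h : HasPatternFamily π a b k) : p * a + (p * q * k + q * b) ≤ Module.finrank ℂ V := by
  obtain ⟨t, x, h⟩ := h
  simpa using h.orthonormal.linearIndependent.fintype_card_le_finrank

/-- Every finite-dimensional unital representation is a direct sum of the irreducible
representations, with fewer than `q` copies of `f ↦ c (f 0)` and fewer than `p` copies of
`f ↦ c (f 1)`, in which copies of `f ↦ f 0` and `f ↦ f 1` are admitted. -/
theorem exists_hasPatternFamily [FiniteDimensional ℂ V] (hp : 0 < p) (hq : 0 < q)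
    (π : DimensionDrop p q →⋆ₐ[ℂ] (V →L[ℂ] V)) :
    ∃ a b k, a < q ∧ b < p ∧ HasPatternFamily π a b k ∧
      p * a + (p * q * k + q * b) = Module.finrank ℂ V := by
  -- Add blocks until the dimension is exhausted; then trade `q` left blocks (`h2`) or `p` right
  -- blocks (`h3`) for one full block until the remainders are small. The trade in `h3` leaves `a`
  -- unchanged.
  have h1 : ∀ d ≤ Module.finrank ℂ V, ∃ a b k, HasPatternFamily π a b k ∧
      d ≤ p * a + (p * q * k + q * b) := by
    intro d
    induction d with
    | zero => exact fun _ => ⟨0, 0, 0, hasPatternFamily_zero, Nat.zero_le _⟩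
    | succ d ih =>
      intro hd
      obtain ⟨a, b, k, h, hle⟩ := ih (by omega)
      rcases hle.lt_or_eq with hlt | heq
      · exact ⟨a, b, k, h, hlt⟩
      · have hpq : 0 < p * q := Nat.mul_pos hp hq
        rcases h.extend hp hq (by omega) with h | h | h
        · exact ⟨_, _, _, h, by rw [mul_add]; omega⟩
        · exact ⟨_, _, _, h, by rw [mul_add]; omega⟩
        · exact ⟨_, _, _, h, by rw [mul_add]; omega⟩
  have h2 : ∀ a b k, HasPatternFamily π a b k →
      p * a + (p * q * k + q * b) = Module.finrank ℂ V → ∃ a b k, a < q ∧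
      HasPatternFamily π a b k ∧ p * a + (p * q * k + q * b) = Module.finrank ℂ V := by
    intro a
    induction a using Nat.strong_induction_on with
    | _ a ih =>
      intro b k h hd
      rcases lt_or_ge a q with ha | ha
      · exact ⟨a, b, k, ha, h, hd⟩
      · obtain ⟨a, rfl⟩ := Nat.exists_eq_add_of_le' ha
        exact ih a (by omega) b (k + 1) h.merge_left (by rw [← hd]; ring)
  have h3 : ∀ b a k, a < q → HasPatternFamily π a b k →
      p * a + (p * q * k + q * b) = Module.finrank ℂ V → ∃ a b k, a < q ∧ b < p ∧
      HasPatternFamily π a b k ∧ p * a + (p * q * k + q * b) = Module.finrank ℂ V := by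
    intro b
    induction b using Nat.strong_induction_on with
    | _ b ih =>
      intro a k ha h hd
      rcases lt_or_ge b p with hb | hb
      · exact ⟨a, b, k, ha, hb, h, hd⟩
      · obtain ⟨b, rfl⟩ := Nat.exists_eq_add_of_le' hb
        exact ih b (by omega) a (k + 1) ha h.merge_right (by rw [← hd]; ring)
  obtain ⟨a, b, k, h, hle⟩ := h1 _ le_rfl
  obtain ⟨a, b, k, ha, h, hd⟩ := h2 a b k h (le_antisymm h.card_le hle)
  exact h3 b a k ha h hd

end Families

end DimensionDrop

namespace DimensionDrop

/-! ### Existence of the normalized eigenvalue pattern -/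

section Pattern

variable {p q p' q' : ℕ}

theorem IsPatternFamily.apply_eq_sum {V : Type*} [NormedAddCommGroup V] [InnerProductSpace ℂ V]
    [CompleteSpace V] {π : DimensionDrop p q →⋆ₐ[ℂ] (V →L[ℂ] V)} {a b k : ℕ} {t : Fin k → I}
    {x : (Fin p × Fin a) ⊕ (((Fin p × Fin q) × Fin k) ⊕ (Fin q × Fin b)) → V}
    (h : IsPatternFamily π t x) (f : DimensionDrop p q) (j) :
    π f (x j) = ∑ i, patternMatrix a b t f i j • x i := by
  rw [Fintype.sum_sum_type, Fintype.sum_sum_type]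
  rcases j with ⟨j, c⟩ | ⟨j, c⟩ | ⟨j, c⟩
  · rw [h.left, Fintype.sum_prod_type]
    simp [patternMatrix, Matrix.blockDiagonal_apply, ite_smul]
  · rw [h.mid, Fintype.sum_prod_type (α₁ := Fin p × Fin q)]
    simp [patternMatrix, Matrix.blockDiagonal_apply, ite_smul]
  · rw [h.right, Fintype.sum_prod_type (α₁ := Fin q)]
    simp [patternMatrix, Matrix.blockDiagonal_apply, ite_smul]

/-- The orthonormal vectors of an exhausting pattern family are the columns of `v`. Allowing every
`e` lets one bijection serve all points `s` later. -/
theorem exists_unitary_conj_patternMatrix {n : Type*} [Fintype n] [DecidableEq n] (hp : 0 < p)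
    (hq : 0 < q) (ρ : DimensionDrop p q →⋆ₐ[ℂ] Matrix n n ℂ) :
    ∃ a b k, a < q ∧ b < p ∧ p * a + (p * q * k + q * b) = Fintype.card n ∧
      ∃ t : Fin k → I, Monotone t ∧
        ∀ e : ((Fin p × Fin a) ⊕ (((Fin p × Fin q) × Fin k) ⊕ (Fin q × Fin b))) ≃ n,
        ∃ v : Matrix.unitaryGroup n ℂ, ∀ f, ρ f = (v : Matrix n n ℂ) *
          Matrix.reindex e e (patternMatrix a b t f) * star (v : Matrix n n ℂ) := by
  obtain ⟨a, b, k, ha, hb, ⟨t₀, x₀, h₀⟩, hcard⟩ := exists_hasPatternFamily hp hq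
    ((StarAlgHomClass.toStarAlgHom (Matrix.toEuclideanCLM (n := n) (𝕜 := ℂ))).comp ρ)
  rw [finrank_euclideanSpace] at hcard
  refine ⟨a, b, k, ha, hb, hcard, t₀ ∘ Tuple.sort t₀, Tuple.monotone_sort t₀, fun e => ?_⟩
  have h := h₀.reindex (Equiv.refl _) (Equiv.refl _) (Tuple.sort t₀)
  revert h
  generalize t₀ ∘ Tuple.sort t₀ = t
  generalize x₀ ∘ _ = x
  intro h
  set v : Matrix n n ℂ := Matrix.of fun i j => x (e.symm j) i with hv
  have hvv : star v * v = 1 := by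
    ext i j
    have := orthonormal_iff_ite.1 h.orthonormal (e.symm i) (e.symm j)
    rw [Matrix.mul_apply, Matrix.one_apply]
    simp only [EmbeddingLike.apply_eq_iff_eq] at this
    rw [← this, PiLp.inner_apply]
    refine Finset.sum_congr rfl fun l _ => ?_
    simp [hv, Matrix.star_apply, mul_comm]
  have hvv' : v * star v = 1 := mul_eq_one_comm.1 hvv
  refine ⟨⟨v, Matrix.mem_unitaryGroup_iff.2 hvv'⟩, fun f => ?_⟩
  have hmul : ρ f * v = v * Matrix.reindex e e (patternMatrix a b t f) := by
    ext i j
    have h1 := congrArg (fun w : EuclideanSpace ℂ n => w i) (h.apply_eq_sum f (e.symm j))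
    rw [Matrix.mul_apply, Matrix.mul_apply,
      ← e.sum_comp fun l => v i l * Matrix.reindex e e (patternMatrix a b t f) l j]
    simp only [WithLp.ofLp_sum, WithLp.ofLp_smul, Finset.sum_apply, Pi.smul_apply] at h1
    refine Eq.trans ?_ (h1.trans ?_)
    · rfl
    · exact Finset.sum_congr rfl fun l _ => by
        simp [hv, mul_comm]
  change ρ f = v * _ * star v
  rw [← hmul, mul_assoc, hvv', mul_one]

/-- Modulo `q` the size determines `p * a`, hence `a`; modulo `p` it determines `b`; then `k`
follows. This is where coprimality enters: the block numbers depend on the matrix size only. -/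
theorem remainders_unique (hpq : p.Coprime q) (hp : 0 < p) (hq : 0 < q) {a b k a' b' k' : ℕ}
    (ha : a < q) (hb : b < p) (ha' : a' < q) (hb' : b' < p)
    (h : p * a + (p * q * k + q * b) = p * a' + (p * q * k' + q * b')) :
    a = a' ∧ b = b' ∧ k = k' := by
  have e₁ : a = a' := by
    have h1 : p * a ≡ p * a' [MOD q] := by
      have h2 : p * a + q * (p * k + b) = p * a' + q * (p * k' + b') := by linarith
      have h3 := congrArg (· % q) h2
      simpa [Nat.ModEq] using h3
    exact Nat.ModEq.eq_of_lt_of_lt (Nat.ModEq.cancel_left_of_coprime hpq.symm h1) ha ha'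
  have e₂ : b = b' := by
    have h1 : q * b ≡ q * b' [MOD p] := by
      have h2 : q * b + p * (q * k + a) = q * b' + p * (q * k' + a') := by linarith
      have h3 := congrArg (· % p) h2
      simpa [Nat.ModEq] using h3
    exact Nat.ModEq.eq_of_lt_of_lt (Nat.ModEq.cancel_left_of_coprime hpq h1) hb hb'
  subst e₁ e₂
  refine ⟨rfl, rfl, ?_⟩
  have h4 : p * q * k = p * q * k' := by omega
  exact Nat.eq_of_mul_eq_mul_left (Nat.mul_pos hp hq) h4

theorem trace_patternMatrix (a b : ℕ) {k : ℕ} (t : Fin k → I) (f : DimensionDrop p q) :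
    (patternMatrix a b t f).trace =
      a * f.left.trace + (∑ i, (f.1 (t i)).trace + b * f.right.trace) := by
  have h : ∀ {m n : Type} [Fintype m] [Fintype n] (A : Matrix m m ℂ) (D : Matrix n n ℂ),
      (Matrix.fromBlocks A 0 0 D).trace = A.trace + D.trace := fun A D => by
    simp [Matrix.trace, Fintype.sum_sum_type]
  rw [patternMatrix, h, h]
  simp [Matrix.trace_blockDiagonal]

theorem trace_unitary_conj_reindex {m n : Type*} [Fintype n] [DecidableEq n] [Fintype m]
    (v : Matrix.unitaryGroup n ℂ) (e : m ≃ n) (P : Matrix m m ℂ) :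
    ((v : Matrix n n ℂ) * Matrix.reindex e e P * star (v : Matrix n n ℂ)).trace = P.trace := by
  rw [Matrix.trace_mul_comm, ← mul_assoc, Unitary.coe_star_mul_self, one_mul]
  exact Fintype.sum_equiv e.symm _ _ fun i => rfl

/-! ### Continuity of sorted families of functions -/

section SortedContinuity

variable {X : Type*} [TopologicalSpace X]

/-- Upper level sets of the members of a sorted family of functions are open if the sums of
all continuous functions of the members are continuous. -/
theorem isOpen_lt_of_continuous_sum {k : ℕ} {t : Fin k → X → ℝ} (hmono : ∀ s, Monotone (t · s))
    (hsum : ∀ g : C(ℝ, ℝ), Continuous fun s => ∑ i, g (t i s)) (i : Fin k) (c : ℝ) :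
    IsOpen {s | c < t i s} := by
  rw [isOpen_iff_mem_nhds]
  intro s₀ hs₀
  have hδ : 0 < t i s₀ - c := sub_pos.2 hs₀
  -- A cut-off that counts: at `s₀` all indices `≥ i` contribute `1`, whereas at a point with `t i s
  -- ≤ c` only indices `> i` contribute, one fewer. Continuity of the sum excludes this near `s₀`.
  set g : C(ℝ, ℝ) := ⟨fun x => min 1 (max 0 ((x - c) / (t i s₀ - c))), by fun_prop⟩ with hg
  have hg1 : ∀ x, g x ≤ 1 := fun x => min_le_left _ _
  have hg0 : ∀ x, 0 ≤ g x := fun x => le_min zero_le_one (le_max_left _ _)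
  have hgc : ∀ x ≤ c, g x = 0 := fun x hx => by
    have : (x - c) / (t i s₀ - c) ≤ 0 := div_nonpos_of_nonpos_of_nonneg (by linarith) hδ.le
    change min 1 (max 0 ((x - c) / (t i s₀ - c))) = 0
    rw [max_eq_left this, min_eq_right zero_le_one]
  have hgi : ∀ x, t i s₀ ≤ x → g x = 1 := fun x hx => by
    have : 1 ≤ (x - c) / (t i s₀ - c) := by rw [one_le_div hδ]; linarith
    exact min_eq_left (this.trans (le_max_right _ _))
  have hlow : ((Finset.Ici i).card : ℝ) ≤ ∑ j, g (t j s₀) := by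
    calc ((Finset.Ici i).card : ℝ) = ∑ j ∈ Finset.Ici i, g (t j s₀) := by
          rw [Finset.sum_congr rfl fun j hj => hgi _ (hmono s₀ (Finset.mem_Ici.1 hj))]
          simp
      _ ≤ _ := Finset.sum_le_sum_of_subset_of_nonneg (Finset.subset_univ _) fun j _ _ => hg0 _
  filter_upwards [(hsum g).continuousAt.eventually (lt_mem_nhds
    (show ((Finset.Ici i).card : ℝ) - 1 < ∑ j, g (t j s₀) by linarith))] with s hs
  by_contra hcon
  rw [not_lt] at hcon
  have hz : ∀ j ∉ Finset.Ioi i, g (t j s) = 0 := fun j hj =>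
    hgc _ ((hmono s (not_lt.1 fun h => hj (Finset.mem_Ioi.2 h))).trans hcon)
  have hup : ∑ j, g (t j s) ≤ (Finset.Ioi i).card := by
    rw [← Finset.sum_subset (Finset.subset_univ (Finset.Ioi i)) fun j _ hj => hz j hj]
    calc _ ≤ ∑ j ∈ Finset.Ioi i, (1 : ℝ) := Finset.sum_le_sum fun j _ => hg1 _
      _ = _ := by simp
  have hcard : ((Finset.Ici i).card : ℝ) = (Finset.Ioi i).card + 1 := by
    rw [← Finset.Ioi_insert, Finset.card_insert_of_notMem (by simp)]
    push_cast; rfl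
  linarith

/-- Lower level sets are upper level sets of the negated family, which is sorted again once the
indices are reversed. -/
theorem continuous_of_continuous_sum {k : ℕ} {t : Fin k → X → ℝ} (hmono : ∀ s, Monotone (t · s))
    (hsum : ∀ g : C(ℝ, ℝ), Continuous fun s => ∑ i, g (t i s)) (i : Fin k) :
    Continuous (t i) := by
  refine OrderTopology.continuous_iff.2 fun c =>
    ⟨isOpen_lt_of_continuous_sum hmono hsum i c, ?_⟩
  have h := isOpen_lt_of_continuous_sum (t := fun j s => -t (Fin.rev j) s)
    (fun s j l hjl => neg_le_neg (hmono s (Fin.rev_le_rev.2 hjl)))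
    (fun g => (hsum (g.comp ⟨fun x => -x, continuous_neg⟩)).congr fun s =>
      (Equiv.sum_comp Fin.revPerm (fun j => g (-t j s))).symm) (Fin.rev i) (-c)
  simp only [Fin.rev_rev, neg_lt_neg_iff] at h
  exact h

end SortedContinuity

/-- The pointwise decompositions share `a`, `b`, `k`. For a central element given by `g`, the trace
of its image is a constant plus `p q ∑ i, g (t_i s)`, so these sums are continuous in `s`, and hence
so are the sorted `t_i`. -/
theorem exists_isNormalizedEigenvaluePattern (hp : 0 < p) (hq : 0 < q) (hpq : p.Coprime q)
    (φ : DimensionDrop p q →⋆ₐ[ℂ] DimensionDrop p' q') :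
    ∃ (k : ℕ) (t : Fin k → C(I, I)), IsNormalizedEigenvaluePattern φ t := by
  have hpt := fun s : I => exists_unitary_conj_patternMatrix hp hq ((evalAt s).comp φ)
  obtain ⟨a, b, k, ha, hb, hcard, -⟩ := hpt 0
  have hpt' : ∀ s : I, ∃ t : Fin k → I, Monotone t ∧
      ∀ e : ((Fin p × Fin a) ⊕ (((Fin p × Fin q) × Fin k) ⊕ (Fin q × Fin b))) ≃
        Fin p' × Fin q',
      ∃ v : Matrix.unitaryGroup (Fin p' × Fin q') ℂ, ∀ f, (φ f).1 s =
        (v : Matrix (Fin p' × Fin q') (Fin p' × Fin q') ℂ) *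
          Matrix.reindex e e (patternMatrix a b t f) *
        star (v : Matrix (Fin p' × Fin q') (Fin p' × Fin q') ℂ) := by
    intro s
    obtain ⟨a', b', k', ha', hb', hcard', h⟩ := hpt s
    obtain ⟨rfl, rfl, rfl⟩ := remainders_unique hpq hp hq ha hb ha' hb' (hcard.trans hcard'.symm)
    exact h
  choose t hmono hv using hpt'
  obtain ⟨e⟩ : Nonempty (((Fin p × Fin a) ⊕ (((Fin p × Fin q) × Fin k) ⊕ (Fin q × Fin b))) ≃
      Fin p' × Fin q') := ⟨Fintype.equivOfCardEq (by rw [← hcard]; simp)⟩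
  choose v hv using fun s => hv s e
  have hcont : ∀ i, Continuous fun s => ((t s i : I) : ℝ) := by
    refine continuous_of_continuous_sum (t := fun i s => ((t s i : I) : ℝ))
      (fun s i j hij => hmono s hij) fun g => ?_
    set f : DimensionDrop p q := scalar ⟨fun x => (g (x : ℝ) : ℂ), by fun_prop⟩ with hf
    have htr : ∀ s, ((φ f).1 s).trace = a * f.left.trace +
        (((p : ℂ) * q) * ∑ i, (g (t s i) : ℂ) + b * f.right.trace) := fun s => by
      rw [hv, trace_unitary_conj_reindex, trace_patternMatrix, Finset.mul_sum]
      congr 2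
      refine Finset.sum_congr rfl fun i _ => ?_
      simp [hf, mul_comm]
    have hne : (p : ℂ) * q ≠ 0 := by
      exact_mod_cast (Nat.mul_pos hp hq).ne'
    have hsum : ∀ s, ∑ i, g (t s i) = ((((φ f).1 s).trace - a * f.left.trace -
        b * f.right.trace) / ((p : ℂ) * q)).re := fun s => by
      rw [htr, show ∀ x y z : ℂ, x + (p * q * y + z) - x - z = y * (p * q) from
        fun x y z => by ring, mul_div_cancel_right₀ _ hne, ← Complex.ofReal_sum,
        Complex.ofReal_re]
    simp_rw [hsum]
    have h1 : Continuous fun s => ((φ f).1 s).trace := (φ f).1.continuous.matrix_trace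
    exact Complex.continuous_re.comp
      (((h1.sub continuous_const).sub continuous_const).div_const _)
  refine ⟨k, fun i => ⟨fun s => t s i, continuous_induced_rng.2 (hcont i)⟩,
    ⟨a, b, ha, hb, e, v, fun f s => hv s f⟩, fun i j hij s => hmono s hij⟩

theorem isNormalizedEigenvaluePattern_eigenvalueFunction (hp : 0 < p) (hq : 0 < q)
    (hpq : p.Coprime q) (φ : DimensionDrop p q →⋆ₐ[ℂ] DimensionDrop p' q') :
    IsNormalizedEigenvaluePattern φ (eigenvalueFunction φ) := by
  have h : ∃ P : Σ k : ℕ, Fin k → C(I, I), IsNormalizedEigenvaluePattern φ P.2 := by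
    obtain ⟨k, t, h⟩ := exists_isNormalizedEigenvaluePattern hp hq hpq φ
    exact ⟨⟨k, t⟩, h⟩
  have h1 : normalizedPattern φ = h.choose := dif_pos h
  change IsNormalizedEigenvaluePattern φ (normalizedPattern φ).2
  rw [h1]
  exact h.choose_spec

/-- The trace formula of the eigenvalue pattern, together with the comparison of sizes. -/
theorem exists_trace_eq (hp : 0 < p) (hq : 0 < q) (hpq : p.Coprime q)
    (φ : DimensionDrop p q →⋆ₐ[ℂ] DimensionDrop p' q') :
    ∃ a b : ℕ, a < q ∧ b < p ∧ p * a + (p * q * patternLength φ + q * b) = p' * q' ∧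
      ∀ (f : DimensionDrop p q) (s : I), ((φ f).1 s).trace = a * f.left.trace +
        (∑ i, (f.1 (eigenvalueFunction φ i s)).trace + b * f.right.trace) := by
  obtain ⟨⟨a, b, ha, hb, e, v, hv⟩, -⟩ :=
    isNormalizedEigenvaluePattern_eigenvalueFunction hp hq hpq φ
  refine ⟨a, b, ha, hb, by simpa using Fintype.card_congr e, fun f s => ?_⟩
  rw [hv, trace_unitary_conj_reindex, trace_patternMatrix]

theorem eigenvalueFunction_mono (hp : 0 < p) (hq : 0 < q) (hpq : p.Coprime q)
    (φ : DimensionDrop p q →⋆ₐ[ℂ] DimensionDrop p' q') {i j : Fin (patternLength φ)}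
    (hij : i ≤ j) (s : I) : eigenvalueFunction φ i s ≤ eigenvalueFunction φ j s :=
  (isNormalizedEigenvaluePattern_eigenvalueFunction hp hq hpq φ).2 i j hij s

end Pattern

end DimensionDrop

namespace DimensionDrop

/-! ### Tracial functionals on dimension drop algebras -/

section Traces

variable {p q : ℕ}

/-- The trace property kills off-diagonal matrix units and identifies all diagonal ones. -/
theorem tracial_functional_eq {n : Type*} [Fintype n] [DecidableEq n] [Nonempty n]
    (L : Matrix n n ℂ →ₗ[ℂ] ℂ) (hL : ∀ A B, L (A * B) = L (B * A)) (A : Matrix n n ℂ) :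
    L A = A.trace / Fintype.card n * L 1 := by
  have hoff : ∀ i j, i ≠ j → L (Matrix.single i j 1) = 0 := fun i j hij => by
    have h := hL (Matrix.single i i 1) (Matrix.single i j 1)
    rwa [Matrix.single_mul_single_same, Matrix.single_mul_single_of_ne _ _ _ _ hij.symm, map_zero,
      mul_one] at h
  have hdiag : ∀ i j, L (Matrix.single i i 1) = L (Matrix.single j j 1) := fun i j => by
    have h := hL (Matrix.single i j 1) (Matrix.single j i 1)
    rwa [Matrix.single_mul_single_same, Matrix.single_mul_single_same, mul_one] at h
  obtain ⟨i₀⟩ := ‹Nonempty n›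
  have hgen : ∀ A, L A = A.trace * L (Matrix.single i₀ i₀ 1) := fun A => by
    conv_lhs => rw [Matrix.matrix_eq_sum_single A]
    rw [map_sum, Matrix.trace, Finset.sum_mul]
    refine Finset.sum_congr rfl fun i _ => ?_
    rw [map_sum, Finset.sum_eq_single i]
    · rw [← mul_one (A i i), ← smul_eq_mul, ← Matrix.smul_single, map_smul, hdiag i i₀]
      simp
    · intro j _ hj
      rw [← mul_one (A i j), ← smul_eq_mul, ← Matrix.smul_single, map_smul, hoff i j hj.symm,
        smul_zero]
    · simp
  have hn : (Fintype.card n : ℂ) ≠ 0 := by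
    have : Nonempty n := ⟨i₀⟩
    exact_mod_cast Fintype.card_ne_zero
  rw [hgen A, hgen 1, Matrix.trace_one]
  field_simp

theorem continuous_div_sqrt_norm : Continuous fun z : ℂ => z / (√‖z‖ : ℝ) := by
  rw [continuous_iff_continuousAt]
  intro z
  rcases eq_or_ne z 0 with rfl | hz
  · rw [ContinuousAt, zero_div, tendsto_zero_iff_norm_tendsto_zero]
    have h : Continuous fun z : ℂ => √‖z‖ := by fun_prop
    have h0 := h.tendsto 0
    rw [norm_zero, Real.sqrt_zero] at h0
    refine h0.congr fun z => ?_
    rw [norm_div, Complex.norm_real, Real.norm_of_nonneg (Real.sqrt_nonneg _), Real.div_sqrt]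
  · refine ContinuousAt.div continuousAt_id (by fun_prop) ?_
    exact_mod_cast (Real.sqrt_pos.2 (norm_pos_iff.2 hz)).ne'

/-- Continuous functions factor into functions with the same zeros. -/
theorem exists_mul_eq {X : Type*} [TopologicalSpace X] (g : C(X, ℂ)) :
    ∃ x y : C(X, ℂ), x * y = g ∧ ∀ s, g s = 0 → x s = 0 ∧ y s = 0 := by
  refine ⟨⟨fun s => (√‖g s‖ : ℝ), by fun_prop⟩,
    ⟨fun s => g s / (√‖g s‖ : ℝ), continuous_div_sqrt_norm.comp g.continuous⟩, ?_, ?_⟩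
  · ext s
    rcases eq_or_ne (g s) 0 with h | h
    · simp [h]
    · have : ((√‖g s‖ : ℝ) : ℂ) ≠ 0 := by
        exact_mod_cast (Real.sqrt_pos.2 (norm_pos_iff.2 h)).ne'
      exact mul_div_cancel₀ _ this
  · intro s h
    simp [h]

/-- The normalized trace `s ↦ tr (f s)`. -/
def normTrace : DimensionDrop p q →ₗ[ℂ] C(I, ℂ) where
  toFun f := ⟨fun s => (f.1 s).trace / (p * q), f.1.continuous.matrix_trace.div_const _⟩
  map_add' f g := by
    ext s
    simp [Matrix.trace_add, add_div]
  map_smul' c f := by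
    ext s
    simp [Matrix.trace_smul, mul_div_assoc]

theorem normTrace_apply (f : DimensionDrop p q) (s : I) :
    normTrace f s = (f.1 s).trace / (p * q) := rfl

/-- The inclusion of the continuous functions as central elements, as a linear map. -/
def scalarLinear : C(I, ℂ) →ₗ[ℂ] DimensionDrop p q where
  toFun := scalar
  map_add' g h := ext_apply fun s => by simp [add_smul]
  map_smul' c g := ext_apply fun s => by simp [mul_smul]

@[simp] theorem scalarLinear_apply (g : C(I, ℂ)) :
    (scalarLinear g : DimensionDrop p q) = scalar g := rfl

/-- Factoring `g = x * y` with the same boundary zeros writes `g • (a b ⊗ 1)` as a product inside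
the algebra. Thus `a ↦ τ (g • (a ⊗ 1))` is tracial on a matrix algebra, hence a multiple of the
trace. -/
theorem tracial_leftElem (τ : DimensionDrop p q →ₗ[ℂ] ℂ)
    (hτ : ∀ f g, τ (f * g) = τ (g * f)) (hp : 0 < p) (hq : 0 < q) (g : C(I, ℂ)) (hg : g 1 = 0)
    (a : Matrix (Fin p) (Fin p) ℂ) :
    τ (leftElem g hg a) = τ (scalar (normTrace (leftElem (q := q) g hg a))) := by
  have : Nonempty (Fin p) := ⟨⟨0, hp⟩⟩
  obtain ⟨x, y, hxy, h0⟩ := exists_mul_eq g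
  have hmul : ∀ a b : Matrix (Fin p) (Fin p) ℂ, leftElem (q := q) g hg (a * b) =
      leftElem x (h0 1 hg).1 a * leftElem y (h0 1 hg).2 b := fun a b => ext_apply fun s => by
    have := Matrix.mul_kronecker_mul a b (1 : Matrix (Fin q) (Fin q) ℂ)
      (1 : Matrix (Fin q) (Fin q) ℂ)
    rw [one_mul] at this
    rw [mul_val_apply, leftElem_val_apply, leftElem_val_apply, leftElem_val_apply, this,
      smul_mul_smul_comm, ← hxy]
    rfl
  have hmul' : ∀ a b : Matrix (Fin p) (Fin p) ℂ, leftElem (q := q) g hg (b * a) =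
      leftElem y (h0 1 hg).2 b * leftElem x (h0 1 hg).1 a := fun a b => ext_apply fun s => by
    have := Matrix.mul_kronecker_mul b a (1 : Matrix (Fin q) (Fin q) ℂ)
      (1 : Matrix (Fin q) (Fin q) ℂ)
    rw [one_mul] at this
    rw [mul_val_apply, leftElem_val_apply, leftElem_val_apply, leftElem_val_apply, this,
      smul_mul_smul_comm, ← hxy, mul_comm x y]
    rfl
  let L : Matrix (Fin p) (Fin p) ℂ →ₗ[ℂ] ℂ :=
    { toFun := fun a => τ (leftElem g hg a)
      map_add' := fun a b => by
        rw [← map_add]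
        exact congrArg τ (ext_apply fun s => by simp [Matrix.add_kronecker])
      map_smul' := fun c a => by
        rw [RingHom.id_apply, ← map_smul]
        exact congrArg τ (ext_apply fun s => by
          rw [smul_val_apply, leftElem_val_apply, leftElem_val_apply, Matrix.smul_kronecker,
            smul_comm]) }
  have h1 := tracial_functional_eq L
    (fun a b => by change τ _ = τ _; rw [hmul, hmul', hτ]) a
  refine h1.trans ?_
  change _ * τ (leftElem g hg 1) = _
  rw [← smul_eq_mul, ← map_smul]
  congr 1
  refine ext_apply fun s => ?_
  have hp' : (p : ℂ) ≠ 0 := by exact_mod_cast hp.ne'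
  have hq' : (q : ℂ) ≠ 0 := by exact_mod_cast hq.ne'
  rw [smul_val_apply, leftElem_val_apply, scalar_val_apply, normTrace_apply, leftElem_val_apply,
    Matrix.trace_smul, Matrix.trace_kronecker, Matrix.one_kronecker_one, Matrix.trace_one,
    smul_smul]
  congr 1
  simp only [Fintype.card_fin, smul_eq_mul]
  field_simp

theorem tracial_rightElem (τ : DimensionDrop p q →ₗ[ℂ] ℂ)
    (hτ : ∀ f g, τ (f * g) = τ (g * f)) (hp : 0 < p) (hq : 0 < q) (g : C(I, ℂ)) (hg : g 0 = 0)
    (b : Matrix (Fin q) (Fin q) ℂ) :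
    τ (rightElem g hg b) = τ (scalar (normTrace (rightElem (p := p) g hg b))) := by
  have : Nonempty (Fin q) := ⟨⟨0, hq⟩⟩
  obtain ⟨x, y, hxy, h0⟩ := exists_mul_eq g
  have hmul : ∀ a b : Matrix (Fin q) (Fin q) ℂ, rightElem (p := p) g hg (a * b) =
      rightElem x (h0 0 hg).1 a * rightElem y (h0 0 hg).2 b := fun a b => ext_apply fun s => by
    have := Matrix.mul_kronecker_mul (1 : Matrix (Fin p) (Fin p) ℂ)
      (1 : Matrix (Fin p) (Fin p) ℂ) a b
    rw [one_mul] at this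
    rw [mul_val_apply, rightElem_val_apply, rightElem_val_apply, rightElem_val_apply, this,
      smul_mul_smul_comm, ← hxy]
    rfl
  have hmul' : ∀ a b : Matrix (Fin q) (Fin q) ℂ, rightElem (p := p) g hg (b * a) =
      rightElem y (h0 0 hg).2 b * rightElem x (h0 0 hg).1 a := fun a b => ext_apply fun s => by
    have := Matrix.mul_kronecker_mul (1 : Matrix (Fin p) (Fin p) ℂ)
      (1 : Matrix (Fin p) (Fin p) ℂ) b a
    rw [one_mul] at this
    rw [mul_val_apply, rightElem_val_apply, rightElem_val_apply, rightElem_val_apply, this,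
      smul_mul_smul_comm, ← hxy, mul_comm x y]
    rfl
  let L : Matrix (Fin q) (Fin q) ℂ →ₗ[ℂ] ℂ :=
    { toFun := fun a => τ (rightElem g hg a)
      map_add' := fun a b => by
        rw [← map_add]
        exact congrArg τ (ext_apply fun s => by simp [Matrix.kronecker_add])
      map_smul' := fun c a => by
        rw [RingHom.id_apply, ← map_smul]
        exact congrArg τ (ext_apply fun s => by
          rw [smul_val_apply, rightElem_val_apply, rightElem_val_apply, Matrix.kronecker_smul,
            smul_comm]) }
  have h1 := tracial_functional_eq L
    (fun a b => by change τ _ = τ _; rw [hmul, hmul', hτ]) b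
  refine h1.trans ?_
  change _ * τ (rightElem g hg 1) = _
  rw [← smul_eq_mul, ← map_smul]
  congr 1
  refine ext_apply fun s => ?_
  have hp' : (p : ℂ) ≠ 0 := by exact_mod_cast hp.ne'
  have hq' : (q : ℂ) ≠ 0 := by exact_mod_cast hq.ne'
  rw [smul_val_apply, rightElem_val_apply, scalar_val_apply, normTrace_apply,
    rightElem_val_apply, Matrix.trace_smul, Matrix.trace_kronecker, Matrix.one_kronecker_one,
    Matrix.trace_one, smul_smul]
  congr 1
  simp only [Fintype.card_fin, smul_eq_mul]
  field_simp

theorem tracial_midElem (τ : DimensionDrop p q →ₗ[ℂ] ℂ)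
    (hτ : ∀ f g, τ (f * g) = τ (g * f)) (hp : 0 < p) (hq : 0 < q) (g : C(I, ℂ)) (hg₀ : g 0 = 0) (hg₁ : g 1 = 0)
    (M : Matrix (Fin p × Fin q) (Fin p × Fin q) ℂ) :
    τ (midElem g hg₀ hg₁ M) = τ (scalar (normTrace (midElem g hg₀ hg₁ M))) := by
  have : Nonempty (Fin p × Fin q) := ⟨⟨⟨0, hp⟩, ⟨0, hq⟩⟩⟩
  obtain ⟨x, y, hxy, h0⟩ := exists_mul_eq g
  let L : Matrix (Fin p × Fin q) (Fin p × Fin q) ℂ →ₗ[ℂ] ℂ :=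
    { toFun := fun a => τ (midElem g hg₀ hg₁ a)
      map_add' := fun a b => by
        rw [← map_add]
        exact congrArg τ (ext_apply fun s => by simp)
      map_smul' := fun c a => by
        rw [RingHom.id_apply, ← map_smul]
        exact congrArg τ (ext_apply fun s => by
          rw [smul_val_apply, midElem_val_apply, midElem_val_apply, smul_comm]) }
  have h1 := tracial_functional_eq L (fun A B => by
    have e₁ : midElem g hg₀ hg₁ (A * B) = midElem x (h0 0 hg₀).1 (h0 1 hg₁).1 A *
        midElem y (h0 0 hg₀).2 (h0 1 hg₁).2 B := ext_apply fun s => by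
      rw [mul_val_apply, midElem_val_apply, midElem_val_apply, midElem_val_apply,
        smul_mul_smul_comm, ← hxy]
      rfl
    have e₂ : midElem g hg₀ hg₁ (B * A) = midElem y (h0 0 hg₀).2 (h0 1 hg₁).2 B *
        midElem x (h0 0 hg₀).1 (h0 1 hg₁).1 A := ext_apply fun s => by
      rw [mul_val_apply, midElem_val_apply, midElem_val_apply, midElem_val_apply,
        smul_mul_smul_comm, ← hxy, mul_comm x y]
      rfl
    change τ _ = τ _
    rw [e₁, e₂, hτ]) M
  refine h1.trans ?_
  change _ * τ (midElem g hg₀ hg₁ 1) = _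
  rw [← smul_eq_mul, ← map_smul]
  congr 1
  refine ext_apply fun s => ?_
  rw [smul_val_apply, midElem_val_apply, scalar_val_apply, normTrace_apply, midElem_val_apply,
    Matrix.trace_smul, smul_smul]
  congr 1
  simp only [Fintype.card_prod, Fintype.card_fin, smul_eq_mul]
  push_cast
  ring

/-- A tracial functional depends on the pointwise trace only. -/
theorem tracial_eq (τ : DimensionDrop p q →ₗ[ℂ] ℂ)
    (hτ : ∀ f g, τ (f * g) = τ (g * f)) (hp : 0 < p) (hq : 0 < q) (f : DimensionDrop p q) :
    τ f = τ (scalar (normTrace f)) := by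
  let Φ : DimensionDrop p q →ₗ[ℂ] ℂ := τ - τ ∘ₗ scalarLinear ∘ₗ normTrace
  suffices h : Φ f = 0 from sub_eq_zero.1 h
  -- Subtracting `(1 - s) • (c (f 0) ⊗ 1)` and `s • (1 ⊗ c (f 1))` leaves an element vanishing at
  -- both endpoints, so its matrix entries can be treated one by one.
  let u : C(I, ℂ) := ⟨fun s => 1 - ((s : ℝ) : ℂ), by fun_prop⟩
  let w : C(I, ℂ) := ⟨fun s => ((s : ℝ) : ℂ), by fun_prop⟩
  let l : DimensionDrop p q := leftElem u (by simp [u]) f.left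
  let r : DimensionDrop p q := rightElem w (by simp [w]) f.right
  let g : Fin p × Fin q → Fin p × Fin q → C(I, ℂ) := fun i j =>
    ⟨fun s => (f - l - r).1 s i j, (f - l - r).1.continuous.matrix_elem i j⟩
  have hg₀ : ∀ i j, g i j 0 = 0 := fun i j => by
    have : (f - l - r).1 0 = 0 := by simp [l, r, u, w, f.left_spec]
    exact congrFun₂ this i j
  have hg₁ : ∀ i j, g i j 1 = 0 := fun i j => by
    have : (f - l - r).1 1 = 0 := by simp [l, r, u, w, f.right_spec]
    exact congrFun₂ this i j
  let m : Fin p × Fin q → Fin p × Fin q → DimensionDrop p q := fun i j =>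
    midElem (g i j) (hg₀ i j) (hg₁ i j) (Matrix.single i j 1)
  have hf' : f - l - r = ∑ i, ∑ j, m i j := by
    refine ext_apply fun s => ?_
    have h1 : (∑ i, ∑ j, m i j).1 s = ∑ i, ∑ j, (m i j).1 s := by
      rw [← evalAt_apply, map_sum]
      simp_rw [map_sum, evalAt_apply]
    rw [h1, Matrix.matrix_eq_sum_single ((f - l - r).1 s)]
    refine Finset.sum_congr rfl fun i _ => Finset.sum_congr rfl fun j _ => ?_
    simp [m, g, Matrix.smul_single]
  have hf : f = l + r + ∑ i, ∑ j, m i j := by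
    rw [← hf']
    abel
  have hl : Φ l = 0 := sub_eq_zero.2 (tracial_leftElem τ hτ hp hq _ _ _)
  have hr : Φ r = 0 := sub_eq_zero.2 (tracial_rightElem τ hτ hp hq _ _ _)
  have hm : ∀ i j, Φ (m i j) = 0 := fun i j =>
    sub_eq_zero.2 (tracial_midElem τ hτ hp hq _ _ _ _)
  rw [hf, map_add, map_add, hl, hr, map_sum]
  simp [map_sum, hm]

/-- A bounded tracial functional is almost determined at elements of almost constant trace. -/
theorem norm_tracial_sub_le (τ : DimensionDrop p q →ₗ[ℂ] ℂ)
    (hτ : ∀ f g, τ (f * g) = τ (g * f)) (hp : 0 < p) (hq : 0 < q) (hτ₁ : τ 1 = 1) {C : ℝ}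
    (hC : ∀ f, ‖τ f‖ ≤ C * ‖f‖) {ε : ℝ} (hε : 0 ≤ ε) (f : DimensionDrop p q)
    (hf : ∀ s, ‖normTrace f s - normTrace f 0‖ ≤ ε) : ‖τ f - normTrace f 0‖ ≤ C * ε := by
  have : Nonempty (Fin p × Fin q) := ⟨⟨⟨0, hp⟩, ⟨0, hq⟩⟩⟩
  have hC0 : 0 ≤ C := by
    by_contra h
    have h1 := hC 1
    rw [hτ₁, norm_one] at h1
    nlinarith [norm_nonneg (1 : DimensionDrop p q), not_le.1 h]
  have h1 : τ f - normTrace f 0 = τ (scalar (normTrace f) - (normTrace f 0) • 1) := by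
    rw [map_sub τ, map_smul, hτ₁, tracial_eq τ hτ hp hq f, smul_eq_mul, mul_one]
  rw [h1]
  refine (hC _).trans (mul_le_mul_of_nonneg_left (norm_le hε fun s => ?_) hC0)
  rw [sub_val_apply, smul_val_apply, scalar_val_apply, one_val_apply, ← sub_smul, norm_smul,
    CStarRing.norm_one, mul_one]
  exact hf s

end Traces

end DimensionDrop

namespace CStarSequence

/-! ### Traces on inductive limits -/

variable {A : ℕ → Type} [∀ n, CStarAlgebra (A n)] (S : CStarSequence A)

theorem toLimit_eq_of_eventuallyEq {x y : S.PreLimit}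
    (h : ∀ᶠ n in atTop, x.entry n = y.entry n) : S.toLimit x = S.toLimit y := by
  have h0 : ‖x - y‖ = 0 := by
    refine tendsto_nhds_unique (x - y).tendsto_norm (tendsto_const_nhds.congr' ?_)
    filter_upwards [h] with n hn
    have : (x - y).entry n = x.entry n - y.entry n := rfl
    rw [this, hn, sub_self, norm_zero]
  have h1 : S.toLimit (x - y) = 0 := by rw [← norm_eq_zero, norm_toLimit, h0]
  rw [← sub_add_cancel x y, toLimit_add, h1, zero_add]

open Classical in
/-- The sequence of images of an element of `A n`, with zeros before the index `n`. -/
def ofLevelSeq (n : ℕ) (f : A n) : S.PreLimit :=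
  ⟨fun l => if h : n ≤ l then S.map h f else 0, n, fun l k hlk hnl => by
    simp only [dif_pos hnl, dif_pos (hnl.trans hlk), ← S.map_trans]⟩

theorem ofLevelSeq_entry {n l : ℕ} (h : n ≤ l) (f : A n) :
    (S.ofLevelSeq n f).entry l = S.map h f := dif_pos h

/-- The canonical map from `A n` to the limit. -/
def ofLevel (n : ℕ) : A n →ₗ[ℂ] S.Limit where
  toFun f := S.toLimit (S.ofLevelSeq n f)
  map_add' f g := by
    rw [← toLimit_add]
    refine S.toLimit_eq_of_eventuallyEq ((eventually_ge_atTop n).mono fun l hl => ?_)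
    refine (S.ofLevelSeq_entry hl _).trans ((map_add (S.map hl) f g).trans ?_)
    rw [← S.ofLevelSeq_entry hl, ← S.ofLevelSeq_entry hl]
    rfl
  map_smul' c f := by
    rw [RingHom.id_apply, ← toLimit_smul]
    refine S.toLimit_eq_of_eventuallyEq ((eventually_ge_atTop n).mono fun l hl => ?_)
    refine (S.ofLevelSeq_entry hl _).trans ((map_smul (S.map hl) c f).trans ?_)
    rw [← S.ofLevelSeq_entry hl]
    rfl

theorem ofLevel_apply (n : ℕ) (f : A n) : S.ofLevel n f = S.toLimit (S.ofLevelSeq n f) := rfl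

theorem ofLevel_mul (n : ℕ) (f g : A n) :
    S.ofLevel n (f * g) = S.ofLevel n f * S.ofLevel n g := by
  rw [ofLevel_apply, ofLevel_apply, ofLevel_apply, ← toLimit_mul]
  refine S.toLimit_eq_of_eventuallyEq ((eventually_ge_atTop n).mono fun l hl => ?_)
  refine (S.ofLevelSeq_entry hl _).trans ((map_mul (S.map hl) f g).trans ?_)
  rw [← S.ofLevelSeq_entry hl, ← S.ofLevelSeq_entry hl]
  rfl

theorem toLimit_one : S.toLimit 1 = 1 := rfl

theorem ofLevel_one (n : ℕ) : S.ofLevel n 1 = 1 := by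
  rw [ofLevel_apply, ← toLimit_one]
  refine S.toLimit_eq_of_eventuallyEq ((eventually_ge_atTop n).mono fun l hl => ?_)
  exact (S.ofLevelSeq_entry hl _).trans (map_one (S.map hl))

theorem norm_ofLevel_le (n : ℕ) (f : A n) : ‖S.ofLevel n f‖ ≤ ‖f‖ := by
  rw [ofLevel_apply, norm_toLimit]
  refine le_of_tendsto (S.ofLevelSeq n f).tendsto_norm
    ((eventually_ge_atTop n).mono fun l hl => ?_)
  rw [S.ofLevelSeq_entry hl]
  exact NonUnitalStarAlgHom.norm_apply_le (S.map hl) f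

theorem eventually_toLimit_eq_ofLevel (x : S.PreLimit) :
    ∀ᶠ n in atTop, S.toLimit x = S.ofLevel n (x.entry n) := by
  obtain ⟨N, hN⟩ := x.2
  refine (eventually_ge_atTop N).mono fun n hn => ?_
  refine S.toLimit_eq_of_eventuallyEq ((eventually_ge_atTop n).mono fun l hl => ?_)
  rw [S.ofLevelSeq_entry hl]
  exact (hN n l hl hn).symm

/-- Two continuous linear functionals on the limit agree if they agree on the images of
coherent sequences. -/
theorem functional_ext {τ τ' : S.Limit →L[ℂ] ℂ}
    (h : ∀ x, τ (S.toLimit x) = τ' (S.toLimit x)) : τ = τ' :=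
  DFunLike.coe_injective (S.denseRange_toLimit.equalizer τ.continuous τ'.continuous (funext h))

/-- Limits of tracial states on the algebras of the sequence along an ultrafilter are tracial
states on the limit. -/
theorem exists_tracialState_of_ultrafilter (U : Ultrafilter ℕ) (hU : (U : Filter ℕ) ≤ atTop)
    (ψ : ∀ n, A n →ₗ[ℂ] ℂ) (hb : ∀ n x, ‖ψ n x‖ ≤ ‖x‖) (h1 : ∀ n, ψ n 1 = 1)
    (htr : ∀ n x y, ψ n (x * y) = ψ n (y * x))
    (hpos : ∀ n x, 0 ≤ (ψ n (star x * x)).re ∧ (ψ n (star x * x)).im = 0) :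
    ∃ τ : S.Limit →L[ℂ] ℂ, IsTracialState τ ∧
      ∀ x : S.PreLimit, Tendsto (fun n => ψ n (x.entry n)) U (𝓝 (τ (S.toLimit x))) := by
  -- The values eventually lie in a compact disc, where ultrafilters converge.
  have hlim : ∀ x : S.PreLimit, ∃ c : ℂ, Tendsto (fun n => ψ n (x.entry n)) U (𝓝 c) := by
    intro x
    have hev : ∀ᶠ n in U, ψ n (x.entry n) ∈ Metric.closedBall (0 : ℂ) (‖x‖ + 1) := by
      have := hU (x.tendsto_norm.eventually (gt_mem_nhds (lt_add_one ‖x‖)))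
      filter_upwards [this] with n hn
      rw [mem_closedBall_zero_iff]
      exact (hb n _).trans (le_of_lt hn)
    obtain ⟨c, -, hc⟩ := (isCompact_closedBall (0 : ℂ) (‖x‖ + 1)).ultrafilter_le_nhds
      (U.map fun n => ψ n (x.entry n)) (le_principal_iff.2 hev)
    exact ⟨c, hc⟩
  choose L hL using hlim
  let L₀ : S.PreLimit →ₗ[ℂ] ℂ :=
    { toFun := L
      map_add' := fun x y => tendsto_nhds_unique (hL (x + y))
        (((hL x).add (hL y)).congr fun n => (map_add (ψ n) (x.entry n) (y.entry n)).symm)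
      map_smul' := fun c x => tendsto_nhds_unique (hL (c • x))
        (((hL x).const_smul c).congr fun n => (map_smul (ψ n) c (x.entry n)).symm) }
  let L₁ : S.PreLimit →L[ℂ] ℂ := L₀.mkContinuous 1 fun x => by
    rw [one_mul]
    exact le_of_tendsto_of_tendsto' (hL x).norm (x.tendsto_norm.mono_left hU)
      fun n => hb n _
  let E : S.PreLimit →L[ℂ] S.Limit :=
    { toFun := S.toLimit
      map_add' := S.toLimit_add
      map_smul' := S.toLimit_smul
      cont := S.continuous_toLimit }
  let τ : S.Limit →L[ℂ] ℂ := L₁.extend E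
  have hE : IsUniformInducing E := (AddMonoidHomClass.isometry_of_norm E
    S.norm_toLimit).isUniformInducing
  have hτ : ∀ x, τ (S.toLimit x) = L x := fun x => L₁.extend_eq S.denseRange_toLimit hE x
  refine ⟨τ, ⟨?_, fun a => ?_, fun a b => ?_⟩, fun x => by rw [hτ]; exact hL x⟩
  · rw [← toLimit_one, hτ]
    exact tendsto_nhds_unique (hL 1) (tendsto_const_nhds.congr fun n => (h1 n).symm)
  · have hc : Continuous fun a : S.Limit => τ (star a * a) :=
      τ.continuous.comp (S.continuous_star_limit.mul continuous_id)
    have hset : IsClosed {z : ℂ | 0 ≤ z.re ∧ z.im = 0} :=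
      (isClosed_le continuous_const Complex.continuous_re).inter
        (isClosed_eq Complex.continuous_im continuous_const)
    refine S.denseRange_toLimit.induction_on (p := fun a => τ (star a * a) ∈
      {z : ℂ | 0 ≤ z.re ∧ z.im = 0}) a (hset.preimage hc) fun x => ?_
    rw [← toLimit_star, ← toLimit_mul, hτ]
    exact hset.mem_of_tendsto (hL _) (Eventually.of_forall fun n => hpos n (x.entry n))
  · refine S.denseRange_toLimit.induction_on₂ (p := fun a b => τ (a * b) = τ (b * a))
      (isClosed_eq (τ.continuous.comp continuous_mul)
        (τ.continuous.comp (continuous_snd.mul continuous_fst))) (fun x y => ?_) a b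
    rw [← toLimit_mul, ← toLimit_mul, hτ, hτ]
    exact tendsto_nhds_unique (hL (x * y)) ((hL (y * x)).congr fun n => htr n _ _)

end CStarSequence

namespace DimensionDrop

/-! ### Crossing numbers and oscillations of traces -/

section Crossing

variable {p q p' q' : ℕ}

theorem norm_entry_le_l2_opNorm {n : Type*} [Fintype n] [DecidableEq n] (M : Matrix n n ℂ)
    (i j : n) : ‖M i j‖ ≤ ‖M‖ := by
  have h := Matrix.l2_opNorm_mulVec M (EuclideanSpace.single j (1 : ℂ))
  rw [PiLp.norm_single, norm_one, mul_one] at h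
  refine le_trans ?_ ((PiLp.norm_apply_le _ i).trans h)
  simp

/-- The normalized trace at a point, as a functional. -/
def traceAt (s : I) : DimensionDrop p q →ₗ[ℂ] ℂ where
  toFun f := normTrace f s
  map_add' f g := by rw [map_add]; rfl
  map_smul' c f := by rw [map_smul]; rfl

theorem traceAt_apply (s : I) (f : DimensionDrop p q) : traceAt s f = normTrace f s := rfl

theorem norm_traceAt_le (hp : 0 < p) (hq : 0 < q) (s : I) (f : DimensionDrop p q) :
    ‖traceAt s f‖ ≤ ‖f‖ := by
  have hpq : (0 : ℝ) < p * q := by exact_mod_cast Nat.mul_pos hp hq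
  rw [traceAt_apply, normTrace_apply, norm_div,
    show ‖((p : ℂ) * q)‖ = (p : ℝ) * q by rw [norm_mul, Complex.norm_natCast, Complex.norm_natCast],
    div_le_iff₀ hpq]
  calc ‖(f.1 s).trace‖ ≤ ∑ i, ‖(f.1 s) i i‖ := norm_sum_le _ _
    _ ≤ ∑ i : Fin p × Fin q, ‖f‖ := Finset.sum_le_sum fun i _ =>
        (norm_entry_le_l2_opNorm _ i i).trans (norm_apply_le f s)
    _ = ‖f‖ * (p * q) := by simp [mul_comm]

theorem traceAt_one (hp : 0 < p) (hq : 0 < q) (s : I) :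
    traceAt s (1 : DimensionDrop p q) = 1 := by
  have hpq : (p : ℂ) * q ≠ 0 := by exact_mod_cast (Nat.mul_pos hp hq).ne'
  rw [traceAt_apply, normTrace_apply, one_val_apply, Matrix.trace_one]
  simp [div_self hpq]

theorem traceAt_mul_comm (s : I) (f g : DimensionDrop p q) :
    traceAt s (f * g) = traceAt s (g * f) := by
  rw [traceAt_apply, traceAt_apply, normTrace_apply, normTrace_apply, mul_val_apply,
    mul_val_apply, Matrix.trace_mul_comm]

theorem traceAt_star_mul_self (s : I) (f : DimensionDrop p q) :
    0 ≤ (traceAt s (star f * f)).re ∧ (traceAt s (star f * f)).im = 0 := by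
  have h : traceAt s (star f * f) =
      (((∑ i, ∑ j, ‖f.1 s j i‖ ^ 2) / (p * q) : ℝ) : ℂ) := by
    rw [traceAt_apply, normTrace_apply, mul_val_apply]
    push_cast
    congr 1
    refine Finset.sum_congr rfl fun i _ => ?_
    rw [Matrix.diag_apply, Matrix.mul_apply]
    refine Finset.sum_congr rfl fun j _ => ?_
    exact RCLike.conj_mul (f.1 s j i)
  rw [h, Complex.ofReal_re, Complex.ofReal_im]
  exact ⟨by positivity, rfl⟩

/-- Each of the two remainder parts is smaller than one full block of size `p q`. -/
theorem mul_patternLength_le (hp : 0 < p) (hq : 0 < q) (hpq : p.Coprime q)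
    (φ : DimensionDrop p q →⋆ₐ[ℂ] DimensionDrop p' q') :
    p * q * patternLength φ ≤ p' * q' ∧ p' * q' ≤ p * q * (patternLength φ + 2) := by
  obtain ⟨a, b, ha, hb, h, -⟩ := exists_trace_eq hp hq hpq φ
  have h1 : p * a ≤ p * q := Nat.mul_le_mul_left _ ha.le
  have h2 : q * b ≤ p * q := by rw [mul_comm p q]; exact Nat.mul_le_mul_left _ hb.le
  exact ⟨by omega, by rw [mul_add]; omega⟩

/-- The remainder blocks contribute the same trace at every point and cancel. -/
theorem normTrace_map_sub (hp : 0 < p) (hq : 0 < q) (hpq : p.Coprime q)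
    (φ : DimensionDrop p q →⋆ₐ[ℂ] DimensionDrop p' q') (f : DimensionDrop p q) (s s' : I) :
    normTrace (φ f) s - normTrace (φ f) s' = ((p * q : ℂ) / (p' * q')) *
      ∑ i, (normTrace f (eigenvalueFunction φ i s) -
        normTrace f (eigenvalueFunction φ i s')) := by
  obtain ⟨a, b, -, -, -, h⟩ := exists_trace_eq hp hq hpq φ
  have hne : (p : ℂ) * q ≠ 0 := by exact_mod_cast (Nat.mul_pos hp hq).ne'
  have hf : ∀ x, (f.1 x).trace = (p * q : ℂ) * normTrace f x := fun x => by
    rw [normTrace_apply, mul_div_cancel₀ _ hne]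
  rw [normTrace_apply, normTrace_apply, h, h]
  simp_rw [hf]
  rw [← Finset.mul_sum, ← Finset.mul_sum, Finset.sum_sub_distrib]
  ring

theorem crossingNumber_eq_sum (φ : DimensionDrop p q →⋆ₐ[ℂ] DimensionDrop p' q') (y ε : ℝ) :
    (crossingNumber φ y ε : ℝ) = ∑ i : Fin (patternLength φ),
      if (⨅ s : I, (eigenvalueFunction φ i s : ℝ)) < y - ε ∧
        y + ε < ⨆ s : I, (eigenvalueFunction φ i s : ℝ) then 1 else 0 := by
  rw [crossingNumber, Set.ncard_eq_toFinset_card', Finset.sum_boole, Set.toFinset_ofPred]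

theorem bddBelow_range_eigenvalueFunction (φ : DimensionDrop p q →⋆ₐ[ℂ] DimensionDrop p' q') (i) :
    BddBelow (Set.range fun s : I => (eigenvalueFunction φ i s : ℝ)) :=
  ⟨0, by rintro _ ⟨s, rfl⟩; exact (eigenvalueFunction φ i s).2.1⟩

theorem bddAbove_range_eigenvalueFunction (φ : DimensionDrop p q →⋆ₐ[ℂ] DimensionDrop p' q') (i) :
    BddAbove (Set.range fun s : I => (eigenvalueFunction φ i s : ℝ)) :=
  ⟨1, by rintro _ ⟨s, rfl⟩; exact (eigenvalueFunction φ i s).2.2⟩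

/-- The oscillation of the trace of `φ f` is controlled by crossing numbers on a grid. -/
theorem norm_normTrace_map_sub_le (hp : 0 < p) (hq : 0 < q) (hpq : p.Coprime q)
    (hp' : 0 < p') (hq' : 0 < q')
    (φ : DimensionDrop p q →⋆ₐ[ℂ] DimensionDrop p' q') (f : DimensionDrop p q) {δ η : ℝ}
    (hη : 0 ≤ η) (hf : ∀ x y : I, dist x y < δ → ‖normTrace f x - normTrace f y‖ ≤ η) {G : ℕ}
    (hG : 0 < G) (hGδ : (1 : ℝ) / G < δ / 4) (s s' : I) :
    ‖normTrace (φ f) s - normTrace (φ f) s'‖ ≤ η + 2 * ‖normTrace f‖ *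
      ∑ j ∈ Finset.range (G + 1),
        (crossingNumber φ (j / G) (δ / 8) : ℝ) / patternLength φ := by
  set k := patternLength φ with hk
  set M := ‖normTrace f‖ with hM
  have hM0 : 0 ≤ M := norm_nonneg _
  have hG' : (0 : ℝ) < G := by exact_mod_cast hG
  have hδ : 0 < δ := by have : (0 : ℝ) < 1 / G := by positivity
                        linarith
  have hterm : ∀ i : Fin k, ‖normTrace f (eigenvalueFunction φ i s) -
      normTrace f (eigenvalueFunction φ i s')‖ ≤ η + 2 * M * ∑ j ∈ Finset.range (G + 1),
        if (⨅ s : I, (eigenvalueFunction φ i s : ℝ)) < (j / G : ℝ) - δ / 8 ∧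
          (j / G : ℝ) + δ / 8 < ⨆ s : I, (eigenvalueFunction φ i s : ℝ)
        then (1 : ℝ) else 0 := by
    intro i
    set lo := ⨅ s : I, (eigenvalueFunction φ i s : ℝ) with hlo
    set hi := ⨆ s : I, (eigenvalueFunction φ i s : ℝ) with hhi
    have hlo_le : ∀ x, lo ≤ eigenvalueFunction φ i x := fun x =>
      ciInf_le (bddBelow_range_eigenvalueFunction φ i) x
    have hle_hi : ∀ x, (eigenvalueFunction φ i x : ℝ) ≤ hi := fun x =>
      le_ciSup (bddAbove_range_eigenvalueFunction φ i) x
    rcases lt_or_ge (hi - lo) δ with h | h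
    · have hd : dist (eigenvalueFunction φ i s) (eigenvalueFunction φ i s') < δ := by
        rw [Subtype.dist_eq, Real.dist_eq, abs_lt]
        constructor <;> linarith [hlo_le s, hle_hi s, hlo_le s', hle_hi s']
      refine (hf _ _ hd).trans (le_add_of_nonneg_right (mul_nonneg (by positivity) ?_))
      exact Finset.sum_nonneg fun j _ => by split_ifs <;> norm_num
    · have hlo0 : 0 ≤ lo := le_ciInf fun x => (eigenvalueFunction φ i x).2.1
      have hhi1 : hi ≤ 1 := ciSup_le fun x => (eigenvalueFunction φ i x).2.2
      set c := (lo + hi) / 2 with hc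
      have hc0 : 0 ≤ c := by rw [hc]; linarith
      have hc1 : c ≤ 1 := by rw [hc]; linarith
      set j := ⌊c * G⌋₊ with hj
      have hj1 : (j : ℝ) / G ≤ c := by
        rw [div_le_iff₀ hG']; exact Nat.floor_le (by positivity)
      have hj2 : c < j / G + 1 / G := by
        rw [← add_div, lt_div_iff₀ hG']; exact Nat.lt_floor_add_one _
      have hjG : j ∈ Finset.range (G + 1) := by
        rw [Finset.mem_range, Nat.lt_succ_iff]
        exact Nat.floor_le_of_le (by nlinarith)
      have hone : (1 : ℝ) ≤ ∑ j ∈ Finset.range (G + 1),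
          if lo < (j / G : ℝ) - δ / 8 ∧ (j / G : ℝ) + δ / 8 < hi then (1 : ℝ) else 0 := by
        refine le_trans ?_ (Finset.single_le_sum (f := fun j : ℕ =>
          if lo < (j / G : ℝ) - δ / 8 ∧ (j / G : ℝ) + δ / 8 < hi then (1 : ℝ) else 0)
          (fun l _ => by split_ifs <;> norm_num) hjG)
        rw [if_pos ⟨by linarith, by linarith⟩]
      calc _ ≤ ‖normTrace f (eigenvalueFunction φ i s)‖ +
            ‖normTrace f (eigenvalueFunction φ i s')‖ := norm_sub_le _ _
        _ ≤ M + M := add_le_add (ContinuousMap.norm_coe_le_norm _ _)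
            (ContinuousMap.norm_coe_le_norm _ _)
        _ = 2 * M * 1 := by ring
        _ ≤ 2 * M * _ := mul_le_mul_of_nonneg_left hone (by positivity)
        _ ≤ _ := le_add_of_nonneg_left hη
  have hR : 0 ≤ ∑ j ∈ Finset.range (G + 1), (crossingNumber φ (j / G) (δ / 8) : ℝ) / k :=
    Finset.sum_nonneg fun j _ => by positivity
  have hsum : ‖∑ i, (normTrace f (eigenvalueFunction φ i s) -
      normTrace f (eigenvalueFunction φ i s'))‖ ≤ k * (η + 2 * M * ∑ j ∈ Finset.range (G + 1),
        (crossingNumber φ (j / G) (δ / 8) : ℝ) / k) := by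
    refine (norm_sum_le_of_le _ fun i _ => hterm i).trans ?_
    rcases Nat.eq_zero_or_pos k with h0 | h0
    · have : IsEmpty (Fin k) := by rw [h0]; infer_instance
      rw [Finset.univ_eq_empty, Finset.sum_empty]
      positivity
    · have hk0 : (k : ℝ) ≠ 0 := by exact_mod_cast h0.ne'
      rw [Finset.sum_add_distrib, ← Finset.mul_sum, Finset.sum_comm, mul_add,
        ← Finset.sum_div]
      rw [Finset.sum_congr rfl fun (j : ℕ) _ =>
        (crossingNumber_eq_sum φ ((j : ℝ) / G) (δ / 8)).symm, Finset.sum_const, Finset.card_univ, Fintype.card_fin, nsmul_eq_mul]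
      refine le_of_eq ?_
      field_simp
  rw [normTrace_map_sub hp hq hpq, norm_mul]
  have hpos : (0 : ℝ) < p' * q' := by exact_mod_cast Nat.mul_pos hp' hq'
  have hnorm : ‖(p * q : ℂ) / (p' * q')‖ = (p * q : ℝ) / (p' * q') := by
    simp
  have hle : (p * q : ℝ) / (p' * q') * k ≤ 1 := by
    rw [div_mul_eq_mul_div, div_le_one hpos]
    exact_mod_cast (mul_patternLength_le hp hq hpq φ).1
  rw [hnorm]
  calc _ ≤ (p * q : ℝ) / (p' * q') * (k * (η + 2 * M * ∑ j ∈ Finset.range (G + 1),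
        (crossingNumber φ (j / G) (δ / 8) : ℝ) / k)) :=
        mul_le_mul_of_nonneg_left hsum (by positivity)
    _ = ((p * q : ℝ) / (p' * q') * k) * (η + 2 * M * ∑ j ∈ Finset.range (G + 1),
        (crossingNumber φ (j / G) (δ / 8) : ℝ) / k) := by ring
    _ ≤ 1 * (η + 2 * M * ∑ j ∈ Finset.range (G + 1),
        (crossingNumber φ (j / G) (δ / 8) : ℝ) / k) :=
        mul_le_mul_of_nonneg_right hle (by positivity)
    _ = _ := one_mul _

/-- The function that is `0` on `[0, y - ε]`, is `1` on `[y + ε, 1]`, and is affine between. -/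
def ramp (y ε : ℝ) : C(I, ℝ) :=
  ⟨fun x => min 1 (max 0 (((x : ℝ) - (y - ε)) / (2 * ε))), by fun_prop⟩

theorem ramp_nonneg (y ε : ℝ) (x : I) : 0 ≤ ramp y ε x := le_min zero_le_one (le_max_left _ _)

theorem ramp_le_one (y ε : ℝ) (x : I) : ramp y ε x ≤ 1 := min_le_left _ _

theorem ramp_eq_zero {y ε : ℝ} (hε : 0 < ε) {x : I} (hx : (x : ℝ) ≤ y - ε) : ramp y ε x = 0 := by
  have : ((x : ℝ) - (y - ε)) / (2 * ε) ≤ 0 :=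
    div_nonpos_of_nonpos_of_nonneg (by linarith) (by positivity)
  change min 1 (max 0 (((x : ℝ) - (y - ε)) / (2 * ε))) = 0
  rw [max_eq_left this, min_eq_right zero_le_one]

theorem ramp_eq_one {y ε : ℝ} (hε : 0 < ε) {x : I} (hx : y + ε ≤ (x : ℝ)) : ramp y ε x = 1 := by
  have : 1 ≤ ((x : ℝ) - (y - ε)) / (2 * ε) := by
    rw [one_le_div (by positivity)]; linarith
  exact min_eq_left (this.trans (le_max_right _ _))

/-- Since the eigenvalue functions are ordered, all crossings can be seen between two points. -/
theorem exists_crossingNumber_le_sum (hp : 0 < p) (hq : 0 < q) (hpq : p.Coprime q)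
    (φ : DimensionDrop p q →⋆ₐ[ℂ] DimensionDrop p' q') (y : ℝ) {ε : ℝ} (hε : 0 < ε) :
    ∃ s s' : I, (crossingNumber φ y ε : ℝ) ≤
      ∑ i, (ramp y ε (eigenvalueFunction φ i s) - ramp y ε (eigenvalueFunction φ i s')) := by
  classical
  set C : Finset (Fin (patternLength φ)) := Finset.univ.filter fun i =>
    (⨅ s : I, (eigenvalueFunction φ i s : ℝ)) < y - ε ∧
    y + ε < ⨆ s : I, (eigenvalueFunction φ i s : ℝ) with hC
  have hmem : ∀ i, i ∈ C ↔ (⨅ s : I, (eigenvalueFunction φ i s : ℝ)) < y - ε ∧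
    y + ε < ⨆ s : I, (eigenvalueFunction φ i s : ℝ) := fun i => by simp [hC]
  have hcard : (crossingNumber φ y ε : ℝ) = ∑ i, if i ∈ C then (1 : ℝ) else 0 := by
    rw [crossingNumber_eq_sum]
    exact Finset.sum_congr rfl fun i _ => by simp only [hmem]
  rcases C.eq_empty_or_nonempty with hE | hne
  · exact ⟨0, 0, by rw [hcard, hE]; simp⟩
  -- At `s` the smallest crossing index is above `y + ε`, hence so are all larger indices; at `s'`
  -- the largest is below `y - ε`, hence so are all smaller ones.
  · obtain ⟨s, hs⟩ := exists_lt_of_lt_ciSup ((hmem _).1 (C.min'_mem hne)).2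
    obtain ⟨s', hs'⟩ := exists_lt_of_ciInf_lt ((hmem _).1 (C.max'_mem hne)).1
    refine ⟨s, s', ?_⟩
    rw [hcard]
    refine Finset.sum_le_sum fun i _ => ?_
    have h1 : C.min' hne ≤ i → ramp y ε (eigenvalueFunction φ i s) = 1 := fun h =>
      ramp_eq_one hε (hs.le.trans (eigenvalueFunction_mono hp hq hpq φ h s))
    have h0 : i ≤ C.max' hne → ramp y ε (eigenvalueFunction φ i s') = 0 := fun h =>
      ramp_eq_zero hε (le_trans (eigenvalueFunction_mono hp hq hpq φ h s') hs'.le)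
    split_ifs with hi
    · rw [h1 (C.min'_le i hi), h0 (C.le_max' i hi), sub_zero]
    -- An index outside `C` lies below the maximum, where the ramp is `0` at `s'`, or above the
    -- minimum, where it is `1` at `s`; either way its difference is nonnegative.
    · rcases le_total i (C.max' hne) with h | h
      · rw [h0 h, sub_zero]
        exact ramp_nonneg _ _ _
      · rw [h1 ((C.min'_le _ (C.max'_mem hne)).trans h), sub_nonneg]
        exact ramp_le_one _ _ _

/-- The ramp function as a central element. -/
def rampElem (y ε : ℝ) : DimensionDrop p q :=
  scalar ⟨fun x => (ramp y ε x : ℂ), by fun_prop⟩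

theorem normTrace_scalar (hp : 0 < p) (hq : 0 < q) (g : C(I, ℂ)) (s : I) :
    normTrace (scalar g : DimensionDrop p q) s = g s := by
  have hne : (p : ℂ) * q ≠ 0 := by exact_mod_cast (Nat.mul_pos hp hq).ne'
  rw [normTrace_apply, scalar_val_apply, Matrix.trace_smul, Matrix.trace_one]
  simp [mul_div_assoc, div_self hne]

/-- The crossing number is bounded by the oscillation of the trace of the ramp function. -/
theorem exists_crossingNumber_div_le (hp : 0 < p) (hq : 0 < q) (hpq : p.Coprime q)
    (hp' : 0 < p') (hq' : 0 < q') (φ : DimensionDrop p q →⋆ₐ[ℂ] DimensionDrop p' q') (y : ℝ)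
    {ε : ℝ} (hε : 0 < ε) : ∃ s s' : I, (crossingNumber φ y ε : ℝ) / patternLength φ ≤
      3 * ‖normTrace (φ (rampElem y ε)) s - normTrace (φ (rampElem y ε)) s'‖ := by
  obtain ⟨s, s', h⟩ := exists_crossingNumber_le_sum hp hq hpq φ y hε
  refine ⟨s, s', ?_⟩
  rcases Nat.eq_zero_or_pos (patternLength φ) with h0 | h0
  · rw [h0, Nat.cast_zero, div_zero]
    positivity
  have hk : (0 : ℝ) < patternLength φ := by exact_mod_cast h0
  have hk1 : (1 : ℝ) ≤ patternLength φ := by exact_mod_cast h0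
  have hpos : (0 : ℝ) < p' * q' := by exact_mod_cast Nat.mul_pos hp' hq'
  have hpq0 : (0 : ℝ) < p * q := by exact_mod_cast Nat.mul_pos hp hq
  have hsize : (p' * q' : ℝ) ≤ p * q * (patternLength φ + 2) := by
    exact_mod_cast (mul_patternLength_le hp hq hpq φ).2
  set R := ∑ i, (ramp y ε (eigenvalueFunction φ i s) - ramp y ε (eigenvalueFunction φ i s'))
    with hR
  have hR0 : 0 ≤ R := le_trans (Nat.cast_nonneg _) h
  have hnorm : ‖normTrace (φ (rampElem y ε)) s - normTrace (φ (rampElem y ε)) s'‖ =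
      (p * q : ℝ) / (p' * q') * R := by
    rw [normTrace_map_sub hp hq hpq]
    have : ∑ i, (normTrace (rampElem (p := p) (q := q) y ε) (eigenvalueFunction φ i s) -
        normTrace (rampElem (p := p) (q := q) y ε) (eigenvalueFunction φ i s')) = (R : ℂ) := by
      rw [hR]
      push_cast
      refine Finset.sum_congr rfl fun i _ => ?_
      rw [rampElem, normTrace_scalar hp hq, normTrace_scalar hp hq]
      rfl
    rw [this, norm_mul, Complex.norm_real, Real.norm_of_nonneg hR0]
    simp
  rw [hnorm, div_le_iff₀ hk]
  -- The constant `3` comes from `k + 2 ≤ 3 k` for `k ≥ 1`, the `2` accounting for the remainder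
  -- blocks.
  have hfac : 1 ≤ 3 * ((p * q : ℝ) / (p' * q')) * patternLength φ := by
    rw [← mul_div_assoc, div_mul_eq_mul_div, one_le_div hpos]
    nlinarith
  calc (crossingNumber φ y ε : ℝ) ≤ 1 * R := by rw [one_mul]; exact h
    _ ≤ 3 * ((p * q : ℝ) / (p' * q')) * patternLength φ * R :=
        mul_le_mul_of_nonneg_right hfac hR0
    _ = _ := by ring

end Crossing

end DimensionDrop

/-! ### Asymptotically constant traces and the equivalence -/

open DimensionDrop in
/-- On the limit, a tracial state is the limit of the normalized traces at `0` if the traces of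
the images of all elements become asymptotically constant. -/
theorem CStarSequence.tendsto_normTrace {p q : ℕ → ℕ} (hp : ∀ n, 0 < p n) (hq : ∀ n, 0 < q n)
    (S : CStarSequence fun n => DimensionDrop (p n) (q n))
    (hosc : ∀ (m : ℕ) (f : DimensionDrop (p m) (q m)) (η : ℝ), 0 < η →
      ∀ᶠ n in atTop, ∀ h : m ≤ n, ∀ s s' : I,
        ‖normTrace (S.map h f) s - normTrace (S.map h f) s'‖ ≤ η)
    {τ : S.Limit →L[ℂ] ℂ} (hτ : IsTracialState τ) (x : S.PreLimit) :
    Tendsto (fun n => normTrace (x.entry n) 0) atTop (𝓝 (τ (S.toLimit x))) := by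
  obtain ⟨N, hN⟩ := id x.2
  rw [Metric.tendsto_nhds]
  intro ε hε
  have hη : 0 < ε / (2 * (‖τ‖ + 1)) := by positivity
  filter_upwards [hosc N (x.entry N) _ hη, S.eventually_toLimit_eq_ofLevel x,
    eventually_ge_atTop N] with n hn hx hNn
  have hmap : S.map hNn (x.entry N) = x.entry n := hN N n hNn le_rfl
  have hn' := hn hNn
  rw [hmap] at hn'
  -- Pulled back to level `n`, `τ` is a tracial functional bounded by `‖τ‖`, so it differs from the
  -- trace at `0` by at most `‖τ‖` times the oscillation.
  let τ₀ : DimensionDrop (p n) (q n) →ₗ[ℂ] ℂ := (τ : S.Limit →ₗ[ℂ] ℂ) ∘ₗ S.ofLevel n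
  have hτ₀ : ∀ f, τ₀ f = τ (S.ofLevel n f) := fun f => rfl
  have key := norm_tracial_sub_le τ₀ (fun f g => by
      rw [hτ₀, hτ₀, S.ofLevel_mul, S.ofLevel_mul, hτ.trace]) (hp n) (hq n)
    (by rw [hτ₀, S.ofLevel_one, hτ.map_one]) (C := ‖τ‖)
    (fun f => (τ.le_opNorm _).trans
      (mul_le_mul_of_nonneg_left (S.norm_ofLevel_le n f) (norm_nonneg _)))
    hη.le (x.entry n) (fun s => hn' s 0)
  rw [dist_comm, dist_eq_norm, hx]
  refine key.trans_lt ?_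
  rw [mul_div_assoc', div_lt_iff₀ (by positivity)]
  nlinarith [norm_nonneg τ]

open DimensionDrop in
/-- If the relative crossing numbers vanish asymptotically, then traces become asymptotically
constant. -/
theorem CStarSequence.eventually_norm_normTrace_sub_le {p q : ℕ → ℕ} (hp : ∀ n, 0 < p n)
    (hq : ∀ n, 0 < q n) (hpq : ∀ n, Nat.Coprime (p n) (q n))
    (S : CStarSequence fun n => DimensionDrop (p n) (q n))
    (hcross : ∀ y ∈ Set.Icc (0 : ℝ) 1, ∀ ε : ℝ, 0 < ε → ∀ m : ℕ,
      Tendsto (fun n : Set.Ici m => (crossingNumber (S.map n.2) y ε : ℝ) /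
        (patternLength (S.map n.2) : ℝ)) atTop (𝓝 0))
    (m : ℕ) (f : DimensionDrop (p m) (q m)) {η : ℝ} (hη : 0 < η) :
    ∀ᶠ n in atTop, ∀ h : m ≤ n, ∀ s s' : I,
      ‖normTrace (S.map h f) s - normTrace (S.map h f) s'‖ ≤ η := by
  obtain ⟨δ, hδ, hf⟩ := Metric.uniformContinuous_iff.1
    (CompactSpace.uniformContinuous_of_continuous (normTrace f).continuous) (η / 2)
    (half_pos hη)
  obtain ⟨G, hG⟩ := exists_nat_one_div_lt (show 0 < δ / 4 by positivity)
  set M := ‖normTrace f‖ with hM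
  have hM0 : 0 ≤ M := norm_nonneg _
  -- The grid depends on `f` and `η` but not on `n`, so the finite sum tends to `0` termwise.
  have hlim : Tendsto (fun n : Set.Ici m => 2 * M * ∑ j ∈ Finset.range (G + 1 + 1),
      (crossingNumber (S.map n.2) (j / (G + 1 : ℕ)) (δ / 8) : ℝ) / patternLength (S.map n.2))
      atTop (𝓝 (2 * M * ∑ j ∈ Finset.range (G + 1 + 1), 0)) := by
    refine Tendsto.const_mul _ (tendsto_finsetSum _ fun j hj => ?_)
    refine hcross _ ⟨by positivity, ?_⟩ _ (by positivity) m
    rw [div_le_one (by positivity)]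
    exact_mod_cast Nat.lt_succ_iff.1 (Finset.mem_range.1 hj)
  rw [Finset.sum_const_zero, mul_zero] at hlim
  obtain ⟨⟨N, hN⟩, hsmall⟩ := eventually_atTop.1
    (hlim.eventually (gt_mem_nhds (half_pos hη)))
  refine (eventually_ge_atTop N).mono fun n hn h s s' => ?_
  have h1 := norm_normTrace_map_sub_le (hp m) (hq m) (hpq m) (hp n) (hq n) (S.map h) f
    (half_pos hη).le (fun x y hxy => by rw [← dist_eq_norm]; exact (hf hxy).le)
    (Nat.succ_pos G) (by push_cast; exact hG) s s'
  have h2 := hsmall ⟨n, h⟩ hn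
  linarith

open DimensionDrop in
/-- In the limit of a sequence with a unique tracial state, traces become asymptotically
constant. -/
theorem CStarSequence.eventually_norm_normTrace_sub_lt_of_isMonotracial {p q : ℕ → ℕ}
    (hp : ∀ n, 0 < p n) (hq : ∀ n, 0 < q n)
    (S : CStarSequence fun n => DimensionDrop (p n) (q n)) (hS : IsMonotracial S.Limit)
    (m : ℕ) (f : DimensionDrop (p m) (q m)) {η : ℝ} (hη : 0 < η) :
    ∀ᶠ n in atTop, ∀ h : m ≤ n, ∀ s s' : I,
      ‖normTrace (S.map h f) s - normTrace (S.map h f) s'‖ < η := by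
  by_contra hcon
  rw [not_eventually] at hcon
  set T : Set ℕ := {n | ¬ ∀ h : m ≤ n, ∀ s s' : I,
      ‖normTrace (S.map h f) s - normTrace (S.map h f) s'‖ < η} with hT
  have hne : (atTop ⊓ 𝓟 T : Filter ℕ).NeBot := frequently_mem_iff_neBot.1 hcon
  -- An ultrafilter concentrated on the infinitely many bad indices: the lower bound `η` survives in
  -- the limit, and the points chosen at good indices do not matter.
  let U := Ultrafilter.of (atTop ⊓ 𝓟 T : Filter ℕ)
  have hU : (U : Filter ℕ) ≤ atTop ⊓ 𝓟 T := Ultrafilter.of_le _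
  have hex : ∀ n, ∃ s s' : I, n ∈ T →
      η ≤ ‖normTrace ((S.ofLevelSeq m f).entry n) s -
        normTrace ((S.ofLevelSeq m f).entry n) s'‖ := by
    intro n
    by_cases hn : n ∈ T
    · have hn' := hn
      rw [hT, Set.mem_ofPred_eq] at hn'
      push Not at hn'
      obtain ⟨h, s, s', hss⟩ := hn'
      exact ⟨s, s', fun _ => by rwa [S.ofLevelSeq_entry h]⟩
    · exact ⟨0, 0, fun h => absurd h hn⟩
  choose s s' hss using hex
  have htrace : ∀ u : ℕ → I, ∃ τ : S.Limit →L[ℂ] ℂ, IsTracialState τ ∧ ∀ x : S.PreLimit,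
      Tendsto (fun n => normTrace (x.entry n) (u n)) U (𝓝 (τ (S.toLimit x))) := fun u =>
    S.exists_tracialState_of_ultrafilter U (hU.trans inf_le_left) (fun n => traceAt (u n))
      (fun n x => norm_traceAt_le (hp n) (hq n) _ x) (fun n => traceAt_one (hp n) (hq n) _)
      (fun n x y => traceAt_mul_comm _ x y) (fun n x => traceAt_star_mul_self _ x)
  obtain ⟨τ, hτ, hlim⟩ := htrace s
  obtain ⟨τ', hτ', hlim'⟩ := htrace s'
  obtain rfl := hS.unique hτ hτ'
  have h0 := ((hlim (S.ofLevelSeq m f)).sub (hlim' (S.ofLevelSeq m f))).norm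
  rw [sub_self, norm_zero] at h0
  refine absurd (ge_of_tendsto h0 ?_) (not_le.2 hη)
  have hTU : ∀ᶠ n in (U : Filter ℕ), n ∈ T := hU.trans inf_le_right (mem_principal_self T)
  exact hTU.mono fun n hn => hss n hn

open DimensionDrop in
theorem CStarSequence.exists_isTracialState {p q : ℕ → ℕ} (hp : ∀ n, 0 < p n)
    (hq : ∀ n, 0 < q n) (S : CStarSequence fun n => DimensionDrop (p n) (q n)) :
    ∃ τ : S.Limit →L[ℂ] ℂ, IsTracialState τ := by
  obtain ⟨τ, hτ, -⟩ := S.exists_tracialState_of_ultrafilter (Ultrafilter.of atTop)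
    (Ultrafilter.of_le _) (fun n => traceAt 0) (fun n x => norm_traceAt_le (hp n) (hq n) _ x)
    (fun n => traceAt_one (hp n) (hq n) _) (fun n x y => traceAt_mul_comm _ x y)
    (fun n x => traceAt_star_mul_self _ x)
  exact ⟨τ, hτ⟩

end

theorem mainTheorem7 (p q : ℕ → ℕ) (hp : ∀ n, 0 < p n) (hq : ∀ n, 0 < q n)
    (hpq : ∀ n, Nat.Coprime (p n) (q n))
    (S : CStarSequence fun n => DimensionDrop (p n) (q n)) :
    IsMonotracial S.Limit ↔
      ∀ y ∈ Set.Icc (0 : ℝ) 1, ∀ ε : ℝ, 0 < ε → ∀ m : ℕ,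
        Tendsto (fun n : Set.Ici m =>
          (DimensionDrop.crossingNumber (S.map n.2) y ε : ℝ) /
            (DimensionDrop.patternLength (S.map n.2) : ℝ)) atTop (𝓝 0) := by
  constructor
  · intro hS y _ ε hε m
    rw [Metric.tendsto_nhds]
    intro δ hδ
    obtain ⟨N, hN⟩ := eventually_atTop.1 <|
      S.eventually_norm_normTrace_sub_lt_of_isMonotracial hp hq hS m
        (DimensionDrop.rampElem y ε) (show 0 < δ / 3 by positivity)
    refine eventually_atTop.2 ⟨⟨max m N, Set.mem_Ici.2 (le_max_left _ _)⟩, fun n hn => ?_⟩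
    obtain ⟨s, s', h⟩ := DimensionDrop.exists_crossingNumber_div_le (hp m) (hq m) (hpq m)
      (hp n) (hq n) (S.map n.2) y hε
    have h1 := hN n ((le_max_right m N).trans hn) n.2 s s'
    rw [Real.dist_eq, sub_zero, abs_of_nonneg (by positivity)]
    linarith
  · intro hcross
    obtain ⟨τ, hτ⟩ := S.exists_isTracialState hp hq
    have hosc := fun m f η (hη : 0 < η) =>
      S.eventually_norm_normTrace_sub_le hp hq hpq hcross m f hη
    -- Both tracial states are limits of the same sequence of traces at `0`.
    exact ⟨τ, hτ, fun τ' hτ' => S.functional_ext fun x =>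
      tendsto_nhds_unique (S.tendsto_normTrace hp hq hosc hτ' x)
        (S.tendsto_normTrace hp hq hosc hτ x)⟩
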